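/- Nested Collision Finding. Write $[n]=\{0,\dots,n-1\}$. Let $\ell\ge 2$ be a constant, let $N,N_0,M\ge 1$, and let $\mathcal D$ be a probability distribution on $[N]$. The input consists of a target $y\leftarrow\mathcal D$ and oracle access to two independent uniformly random functions $H:[M]\to[N]$ and $G:[M]^\ell\to[N_0]$. The goal is to output two different $\ell$-tuples $x_1<\dots<x_\ell$ and $x'_1<\dots<x'_\ell$ of elements of $[M]$ with $\sum_i H(x_i)\equiv\sum_i H(x'_i)\equiv y \pmod N$ and $G(x_1,\dots,x_\ell)=G(x'_1,\dots,x'_\ell)$. A classical algorithm with space $S$ and $T$ queries is a randomized algorithm with read-only access to $y$ that keeps $S$ bits of memory from one oracle query to the next and makes $T$ queries in total to $H$ and $G$; its computation between queries, and its randomness, are free. All constants below are independent of $N$, $M$, $S$, $T$, $\mathcal D$ and the algorithm. Theorem. Let $\ell\ge2$, let $\frac1\ell<\varepsilon\le\frac2{\ell-1}$, and let $N_0=N_0(N)=\Theta(N^{\varepsilon})$. Then $\ell$-Nested Collision Finding has a classical space–time tradeoff, in the following sense. (1) For all $p,a,b>0$ there is $c>0$ such that for all large $N$, all $M$ and all $\mathcal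 D$, every classical algorithm with space $S$, $a\log N\le S\le b\,N^{1/(\ell^2-1)}$, and $T$ queries that succeeds with probability at least $p$ satisfies $S^{\frac{\ell^2-1}{2\ell}}\,T\ \ge\ c\,N^{\frac1{2\ell}+\frac\varepsilon2}$. (2) For all $p,a>0$ there is $c>0$ such that for all large $N$, all $M$ and all $\mathcal D$, every classical algorithm with space $S\le a\log N$ and $T$ queries that succeeds with probability at least $p$ satisfies $T\ge c\,N^{\frac1{2\ell}+\frac\varepsilon2}$. (3) For every $p<1$ there is $C>0$ such that for all large $N$ and all $M\ge C N^{\frac1\ell+\frac{\varepsilon}{2\ell}}$ there is a classical algorithm (with no bound on its space) that makes at most $C N^{\frac1\ell+\frac{\varepsilon}{2\ell}}$ queries and succeeds with probability at least $p$ for every $\mathcal D$. (4) Small space makes the query count of (3) impossible: there is $\delta>0$, depending only on $\ell$, $\varepsilon$ and $N_0(\cdot)$, such that for every $p>0$, all large $N$, all $M$ and all $\mathcal D$, every classical algorithm with space $S\le N^{\delta}$ and $T$ queries that succeeds with probability at least $p$ satisfies $T\ge N^{\frac1\ell+\frac{\varepsilon}{2\ell}+\delta}$. Example. Let $\ell=2$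 and $N_0=N^2$. For all $p,a,b>0$ there is $c>0$ such that for all large $N$, all $M$ and all $\mathcal D$, every classical algorithm with $a\log N\le S\le bN^{1/3}$ that succeeds with probability at least $p$ satisfies $S^{3/4}T\ge cN^{5/4}$. For every $p>0$ and every $k$ there is $k'$ such that for all large $N$, all $M$ and all $\mathcal D$, every classical algorithm with $S\le(\log N)^k$ that succeeds with probability at least $p$ satisfies $T\ge N^{5/4}/(\log N)^{k'}$. On the other hand, for every $p<1$ there is $C>0$ such that for all large $N$ and all $M\ge CN$ some classical algorithm (with no bound on its space) makes at most $CN$ queries and succeeds with probability at least $p$ for every $\mathcal D$. This is optimal: for every $p>0$ there is $c>0$ such that for all large $N$, all $M$ and all $\mathcal D$, every classical algorithm, whatever its space, that succeeds with probability at least $p$ makes at least $cN$ queries. -/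

import Mathlib

open Filter Asymptotics
open scoped ENNReal BigOperators

namespace NestedCollision

/-- An `ℓ`-tuple of points of `[M] = {0, …, M-1}`, listed in order. -/
abbrev Tuple (ℓ M : ℕ) : Type := Fin ℓ → Fin M

/-- The pair `(x, x')` is a nested collision for the oracles `H : [M] → [N]`, `G : [M]^ℓ → [N₀]`
and the target `y`: two different, strictly increasing `ℓ`-tuples, both with `H`-sum `y` modulo
`N`, and with the same `G`-value. -/
def IsNestedCollision {ℓ M N N₀ : ℕ} (H : Fin M → Fin N) (G : Tuple ℓ M → Fin N₀) (y : Fin N)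
    (x x' : Tuple ℓ M) : Prop :=
  x ≠ x' ∧ StrictMono x ∧ StrictMono x' ∧
    (∑ i, (H (x i) : ℕ)) ≡ (y : ℕ) [MOD N] ∧
    (∑ i, (H (x' i) : ℕ)) ≡ (y : ℕ) [MOD N] ∧
    G x = G x'

/-- The contents of a memory of `S` bits. -/
abbrev Memory (S : ℕ) : Type := Fin S → Bool

/-- A deterministic classical query algorithm with `S` bits of memory and read-only access to the
target `y`. In step `t` it asks one oracle query, which is either a point for `H` or a tuple for
`G`, determined by `y`, `t` and the memory; the answer then updates the memory. Local computation
between queries is free and arbitrary, and may depend on the step number. -/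
structure DetAlgorithm (ℓ M N N₀ S : ℕ) where
  init : Fin N → Memory S
  query : Fin N → ℕ → Memory S → Fin M ⊕ Tuple ℓ M
  update : Fin N → ℕ → Memory S → Fin N ⊕ Fin N₀ → Memory S
  output : Fin N → Memory S → Tuple ℓ M × Tuple ℓ M

/-- The memory after `t` oracle queries. -/
def DetAlgorithm.memoryAfter {ℓ M N N₀ S : ℕ} (P : DetAlgorithm ℓ M N N₀ S)
    (H : Fin M → Fin N) (G : Tuple ℓ M → Fin N₀) (y : Fin N) : ℕ → Memory S
  | 0 => P.init y
  | t + 1 =>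
      let m := P.memoryAfter H G y t
      P.update y t m (Sum.map H G (P.query y t m))

/-- After `T` oracle queries the algorithm outputs a nested collision. -/
def DetAlgorithm.Wins {ℓ M N N₀ S : ℕ} (P : DetAlgorithm ℓ M N N₀ S) (T : ℕ)
    (H : Fin M → Fin N) (G : Tuple ℓ M → Fin N₀) (y : Fin N) : Prop :=
  IsNestedCollision H G y
    (P.output y (P.memoryAfter H G y T)).1 (P.output y (P.memoryAfter H G y T)).2

/-- The probability, over independent uniformly random functions `H` and `G`, that the algorithm
wins on the target `y` with `T` queries. -/
noncomputable def DetAlgorithm.winProb {ℓ M N N₀ S : ℕ} (P : DetAlgorithm ℓ M N N₀ S) (T : ℕ)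
    (y : Fin N) : ℝ≥0∞ :=
  (Nat.card {O : (Fin M → Fin N) × (Tuple ℓ M → Fin N₀) // P.Wins T O.1 O.2 y} : ℝ≥0∞) /
    (Nat.card ((Fin M → Fin N) × (Tuple ℓ M → Fin N₀)) : ℝ≥0∞)

/-- A randomized classical query algorithm with `S` bits of memory: a probability distribution on
deterministic ones (the outcome of all its coin tosses; these do not count as memory). -/
abbrev RandAlgorithm (ℓ M N N₀ S : ℕ) : Type := PMF (DetAlgorithm ℓ M N N₀ S)

/-- The probability that the randomized algorithm `A`, making `T` oracle queries, solves the nested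
collision finding problem with target distribution `D`; the coins of `A`, the target and the two
oracles are independent. -/
noncomputable def successProb {ℓ M N N₀ S : ℕ} (A : RandAlgorithm ℓ M N N₀ S) (D : PMF (Fin N))
    (T : ℕ) : ℝ≥0∞ :=
  ∑' P : DetAlgorithm ℓ M N N₀ S, A P * ∑ y : Fin N, D y * P.winProb T y

end NestedCollision

/-!
Both directions of the theorem reduce to counting *valid* tuples, that is, increasing tuples with
`H`-sum `y`. About `√N₀ ≈ N ^ (ε / 2)` of them have to be seen before two have the same `G`-value.

*Lower bounds.* Fix the target and a deterministic algorithm. However the queries are chosen, among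
the first `k` valid tuples queried a collision of `G` has probability at most `k ^ 2 / N₀`
(`card_hasCollision_le`), so it remains to bound the number of valid tuples queried
(`DetAlgorithm.winProb_le`). Every query is charged with querying `H` at all points of its tuple;
then the valid tuples are solutions of an `ℓ`-sum problem among adaptively queried points.

* Without a bound on the space, `T` queries see at most about `T ^ ℓ / N` solutions on average
  (`sum_card_solutions_le`), whence `T ≥ c N ^ (1 / ℓ + ε / (2 ℓ))` (`queries_lower_bound`).
* With `S` bits of memory, the computation is cut into blocks of `τ` queries, where `τ ^ ℓ` is of
  order `r * N` and `r = S + O(log N)`. A block is a computation with unbounded memory started from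
  one of `2 ^ S` memory contents. Call a queried point a hit for a sum `u` if it completes a
  solution with sum `u` and at most `ℓ` points. A new point is a hit with probability of order
  `τ ^ (ℓ - 1) / N`, so a Chernoff bound gives at most `r` hits except with probability
  `2 ^ (-r)` (`card_hitSet_ge_le`), which survives a union bound over the memory, the blocks and
  `u`. The point of a solution that was queried last is a hit, and removing it leaves a smaller
  solution for another sum; hence a block sees at most `r ^ ℓ` solutions (`card_solutions_le`), and
  `T / τ` blocks see `T * r ^ (ℓ - 1 / ℓ) / N ^ (1 / ℓ)` of them (`memory_lower_bound`). For
  `S ≤ b N ^ (1 / (ℓ ^ 2 - 1))` this is stronger than the stated tradeoff. It needs at least one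
  full block; when `T < τ`, the bound without space restrictions forces `r` to be at least of order
  `N ^ (ε / 2)`, and then that bound alone implies the tradeoff.

The estimates for adaptive queries all come from `IsSupermartingale.sum_le`: a potential which does
not increase on average when a fresh point is queried does not increase in expectation. The
probabilistic content of that lemma is that resampling `H` at the next fresh query preserves the
uniform distribution (`sum_sum_update_eq`).

*Upper bound.* The algorithm queries `H` at `ℓ` blocks of `q ≈ N ^ (1 / ℓ + ε / (2 ℓ))` points, then
`G` at `O(N ^ (ε / 2))` of the valid tuples that have one point in each block, and remembers
everything. Chebyshev's inequality shows that there are enough valid tuples, and that their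
`G`-values collide (`exists_algorithm_winProb_ge`). The assumption `ε ≤ 2 / (ℓ - 1)` says that the
`G`-queries do not dominate.
-/

namespace NestedCollision

/-! ### Adaptive queries to a random function -/

section QueryProcess

variable {X Y α β : Type*}

/-- `f H` can be computed from the values of `H` at the points of the list `L H`. -/
def DeterminedBy (L : (X → Y) → List X) (f : (X → Y) → α) : Prop :=
  ∀ H H' : X → Y, (∀ x ∈ L H, H' x = H x) → f H' = f H

theorem DeterminedBy.mono {L L' : (X → Y) → List X} {f : (X → Y) → α} (hf : DeterminedBy L f)
    (h : ∀ H, L H ⊆ L' H) : DeterminedBy L' f :=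
  fun H H' hH => hf H H' fun x hx => hH x (h H hx)

theorem DeterminedBy.comp {L : (X → Y) → List X} {f : (X → Y) → α} (hf : DeterminedBy L f)
    (g : α → β) : DeterminedBy L fun H => g (f H) :=
  fun H H' hH => congrArg g (hf H H' hH)

/-- `L H` is the history, latest query first, of `n` adaptive queries to `H`: each query is
computed from the answers to the earlier ones. Queries may be repeated. -/
inductive QueryProcess : ℕ → ((X → Y) → List X) → Prop
  | nil : QueryProcess 0 fun _ => []
  | cons {n : ℕ} {L : (X → Y) → List X} {x : (X → Y) → X} :
      QueryProcess n L → DeterminedBy L x → QueryProcess (n + 1) fun H => x H :: L H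

theorem QueryProcess.length_eq {n : ℕ} {L : (X → Y) → List X} (h : QueryProcess n L) (H : X → Y) :
    (L H).length = n := by
  induction h with
  | nil => rfl
  | cons _ _ ih => simp [ih]

theorem QueryProcess.determinedBy {n : ℕ} {L : (X → Y) → List X} (h : QueryProcess n L) :
    DeterminedBy L L := by
  induction h with
  | nil => intro _ _ _; rfl
  | cons _ hx ih =>
    intro H H' hH
    simp only
    rw [hx H H' fun z hz => hH z (List.mem_cons_of_mem _ hz),
      ih H H' fun z hz => hH z (List.mem_cons_of_mem _ hz)]

/-- A block of queries that are all determined by the history can be appended at once. -/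
theorem QueryProcess.append_ofFn {n k : ℕ} {L : (X → Y) → List X} (h : QueryProcess n L)
    (z : (X → Y) → Fin k → X) (hz : DeterminedBy L z) :
    QueryProcess (n + k) fun H => List.ofFn (z H) ++ L H := by
  induction k with
  | zero => simpa using h
  | succ k ih =>
    have h1 := ih (fun H i => z H i.succ) (hz.comp fun u (i : Fin k) => u i.succ)
    have h2 : DeterminedBy (fun H => List.ofFn (fun i : Fin k => z H i.succ) ++ L H)
        fun H => z H 0 :=
      (hz.comp fun u => u 0).mono fun H => List.subset_append_right _ _
    simpa [List.ofFn_succ, Nat.add_assoc] using h1.cons h2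

variable [Fintype X] [DecidableEq X] [Fintype Y]

/-- Resampling the value of a uniformly random function at a point `x H`, on an event which
neither the event nor the point notices, leaves the distribution unchanged. -/
theorem sum_sum_update_eq (A : (X → Y) → Prop) [DecidablePred A] (x : (X → Y) → X)
    (hA : ∀ H v, A H → A (Function.update H (x H) v) ∧ x (Function.update H (x H) v) = x H)
    (F : (X → Y) → ℝ) :
    ∑ H with A H, ∑ v : Y, F (Function.update H (x H) v) =
      Fintype.card Y * ∑ H with A H, F H := by
  have h1 : (Fintype.card Y : ℝ) * ∑ H with A H, F H = ∑ H with A H, ∑ _v : Y, F H := by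
    simp [Finset.mul_sum]
  rw [h1, ← Finset.sum_product', ← Finset.sum_product']
  refine Finset.sum_nbij' (fun p => (Function.update p.1 (x p.1) p.2, p.1 (x p.1)))
    (fun p => (Function.update p.1 (x p.1) p.2, p.1 (x p.1))) ?_ ?_ ?_ ?_ ?_
  · rintro ⟨H, v⟩ h
    simp only [Finset.mem_product, Finset.mem_filter, Finset.mem_univ, true_and, and_true] at h ⊢
    exact (hA H v h).1
  · rintro ⟨H, v⟩ h
    simp only [Finset.mem_product, Finset.mem_filter, Finset.mem_univ, true_and, and_true] at h ⊢
    exact (hA H v h).1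
  · rintro ⟨H, v⟩ h
    simp only [Finset.mem_product, Finset.mem_filter, Finset.mem_univ, true_and, and_true] at h
    simp [(hA H v h).2]
  · rintro ⟨H, v⟩ h
    simp only [Finset.mem_product, Finset.mem_filter, Finset.mem_univ, true_and, and_true] at h
    simp [(hA H v h).2]
  · intro p _
    rfl

/-- `w L H` is a potential of the list `L` of points queried so far and of the function `H` which,
while `L` is shorter than `n`, does not increase on average when a new point is queried and its
value resampled, and does not increase at all when a query is repeated. -/
structure IsSupermartingale (n : ℕ) (w : List X → (X → Y) → ℝ) : Prop where
  repeated : ∀ (L : List X) (H : X → Y) (x : X), L.length < n → x ∈ L → w (x :: L) H ≤ w L H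
  fresh : ∀ (L : List X) (H : X → Y) (x : X), L.length < n → x ∉ L →
    ∑ v : Y, w (x :: L) (Function.update H x v) ≤ Fintype.card Y * w L H

/-- Along adaptive queries to a uniformly random function, the expectation of a supermartingale
potential does not increase. -/
theorem IsSupermartingale.sum_le [Nonempty Y] {n k : ℕ} {w : List X → (X → Y) → ℝ}
    (hw : IsSupermartingale n w) {L : (X → Y) → List X} (h : QueryProcess k L) (hk : k ≤ n) :
    ∑ H, w (L H) H ≤ ∑ H, w [] H := by
  induction h with
  | nil => exact le_rfl
  | @cons k L x hL hx ih =>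
    refine le_trans ?_ (ih (by omega))
    have hlen : ∀ H, (L H).length < n := fun H => by rw [hL.length_eq]; omega
    classical
    rw [← Finset.sum_filter_add_sum_filter_not Finset.univ (fun H => x H ∈ L H),
      ← Finset.sum_filter_add_sum_filter_not Finset.univ (fun H => x H ∈ L H) (fun H => w (L H) H)]
    refine add_le_add (Finset.sum_le_sum fun H hH => hw.repeated _ _ _ (hlen H) (by simpa using hH))
      ?_
    have hupd : ∀ H v, x H ∉ L H → (L (Function.update H (x H) v) = L H ∧
        x (Function.update H (x H) v) = x H) := by
      intro H v hH
      have : ∀ z ∈ L H, Function.update H (x H) v z = H z := by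
        intro z hz
        rw [Function.update_of_ne]
        rintro rfl
        exact hH hz
      exact ⟨hL.determinedBy _ _ this, hx _ _ this⟩
    have key := sum_sum_update_eq (fun H => x H ∉ L H) x
      (fun H v hH => by rw [(hupd H v hH).1, (hupd H v hH).2]; exact ⟨hH, rfl⟩)
      (fun H => w (x H :: L H) H)
    have hpos : (0 : ℝ) < Fintype.card Y := by exact_mod_cast Fintype.card_pos
    refine le_of_mul_le_mul_left ?_ hpos
    rw [← key, Finset.mul_sum]
    refine Finset.sum_le_sum fun H hH => ?_
    have hH' : x H ∉ L H := by simpa using hH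
    refine le_trans (le_of_eq (Finset.sum_congr rfl fun v _ => ?_)) (hw.fresh _ H _ (hlen H) hH')
    rw [(hupd H v hH').1, (hupd H v hH').2]

end QueryProcess

/-! ### Solutions among adaptively queried points -/

section Solutions

variable {X Y Z : Type*} [DecidableEq X] [AddCommGroup Z]

theorem sum_congr_of_agree (φ : Y → Z) {L : List X} {H H' : X → Y} (h : ∀ x ∈ L, H' x = H x)
    {A : Finset X} (hA : A ⊆ L.toFinset) : ∑ z ∈ A, φ (H' z) = ∑ z ∈ A, φ (H z) :=
  Finset.sum_congr rfl fun z hz => by rw [h z (by simpa using hA hz)]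

variable [DecidableEq Z]

/-- The `j`-element sets of points of `L` whose values under `φ ∘ H` add up to `u`. -/
def solutions (φ : Y → Z) (j : ℕ) (u : Z) (L : List X) (H : X → Y) : Finset (Finset X) :=
  {A ∈ L.toFinset.powersetCard j | ∑ z ∈ A, φ (H z) = u}

open Classical in
/-- The points of `L` (whose latest entry comes first) at whose first query a solution with
sum `u` and at most `ℓ` points was completed. -/
noncomputable def hitSet (φ : Y → Z) (ℓ : ℕ) (u : Z) : List X → (X → Y) → Finset X
  | [], _ => ∅
  | x :: L, H =>
      if x ∉ L ∧ ∃ A ⊆ L.toFinset, A.card < ℓ ∧ φ (H x) + ∑ z ∈ A, φ (H z) = u then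
        insert x (hitSet φ ℓ u L H)
      else hitSet φ ℓ u L H

theorem solutions_congr (φ : Y → Z) (j : ℕ) (u : Z) {L : List X} {H H' : X → Y}
    (h : ∀ x ∈ L, H' x = H x) : solutions φ j u L H' = solutions φ j u L H := by
  refine Finset.filter_congr fun A hA => ?_
  rw [sum_congr_of_agree φ h (Finset.mem_powersetCard.1 hA).1]

theorem hitSet_congr (φ : Y → Z) (ℓ : ℕ) (u : Z) (L : List X) {H H' : X → Y}
    (h : ∀ x ∈ L, H' x = H x) : hitSet φ ℓ u L H' = hitSet φ ℓ u L H := by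
  induction L with
  | nil => rfl
  | cons x L ih =>
    have hL : ∀ z ∈ L, H' z = H z := fun z hz => h z (List.mem_cons_of_mem _ hz)
    have : (∃ A ⊆ L.toFinset, A.card < ℓ ∧ φ (H' x) + ∑ z ∈ A, φ (H' z) = u) ↔
        ∃ A ⊆ L.toFinset, A.card < ℓ ∧ φ (H x) + ∑ z ∈ A, φ (H z) = u := by
      refine exists_congr fun A => and_congr_right fun hA => ?_
      rw [sum_congr_of_agree φ hL hA, h x List.mem_cons_self]
    simp only [hitSet, ih hL, this]

/-- Every solution contains a hit, namely its point that was queried last. -/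
theorem exists_mem_hitSet (φ : Y → Z) {ℓ : ℕ} {u : Z} {L : List X} {H : X → Y} {A : Finset X}
    (hA : A ⊆ L.toFinset) (hne : A.Nonempty) (hcard : A.card ≤ ℓ)
    (hsum : ∑ z ∈ A, φ (H z) = u) : ∃ x ∈ A, x ∈ hitSet φ ℓ u L H := by
  induction L with
  | nil => simp_all
  | cons x L ih =>
    by_cases h : A ⊆ L.toFinset
    · obtain ⟨z, hz, hz'⟩ := ih h
      refine ⟨z, hz, ?_⟩
      rw [hitSet]
      split_ifs
      · exact Finset.mem_insert_of_mem hz'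
      · exact hz'
    · have hx : x ∈ A := by
        by_contra hx
        refine h fun z hz => ?_
        have := hA hz
        simp only [List.toFinset_cons, Finset.mem_insert] at this
        rcases this with rfl | this
        · exact absurd hz hx
        · exact this
      have hxL : x ∉ L := by
        intro hxL
        apply h
        rwa [List.toFinset_cons, Finset.insert_eq_of_mem (by simpa using hxL)] at hA
      refine ⟨x, hx, ?_⟩
      rw [hitSet, if_pos]
      · exact Finset.mem_insert_self _ _
      · refine ⟨hxL, A.erase x, ?_, ?_, ?_⟩
        · rw [List.toFinset_cons] at hA
          rwa [Finset.subset_insert_iff] at hA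
        · exact lt_of_lt_of_le (Finset.card_erase_lt_of_mem hx) hcard
        · rw [← hsum, Finset.add_sum_erase A (fun z => φ (H z)) hx]

/-- Few hits for every sum leave room for few solutions: removing the last queried point from a
solution leaves a solution for another sum. -/
theorem card_solutions_le (φ : Y → Z) {ℓ r : ℕ} {L : List X} {H : X → Y}
    (hr : ∀ u, (hitSet φ ℓ u L H).card ≤ r) {j : ℕ} (hj : j ≤ ℓ) (u : Z) :
    (solutions φ j u L H).card ≤ r ^ j := by
  induction j generalizing u with
  | zero =>
    refine (Finset.card_filter_le _ _).trans ?_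
    simp
  | succ j ih =>
    have hsub : solutions φ (j + 1) u L H ⊆ (hitSet φ ℓ u L H).biUnion fun x =>
        (solutions φ j (u - φ (H x)) L H).image (insert x) := by
      intro A hA
      obtain ⟨hA, hsum⟩ := Finset.mem_filter.1 hA
      obtain ⟨hAL, hc⟩ := Finset.mem_powersetCard.1 hA
      obtain ⟨x, hxA, hx⟩ := exists_mem_hitSet φ hAL (Finset.card_pos.1 (by omega))
        (hc.le.trans hj) hsum
      refine Finset.mem_biUnion.2 ⟨x, hx, Finset.mem_image.2 ⟨A.erase x, ?_,
        Finset.insert_erase hxA⟩⟩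
      refine Finset.mem_filter.2 ⟨Finset.mem_powersetCard.2
        ⟨(Finset.erase_subset _ _).trans hAL, ?_⟩, ?_⟩
      · rw [Finset.card_erase_of_mem hxA, hc]; rfl
      · rw [← hsum, ← Finset.add_sum_erase A (fun z => φ (H z)) hxA]
        abel
    refine (Finset.card_le_card hsub).trans ?_
    refine (Finset.card_biUnion_le_card_mul _ _ (r ^ j) fun x _ =>
      Finset.card_image_le.trans (ih (by omega) _)).trans ?_
    rw [pow_succ']
    exact Nat.mul_le_mul_right _ (hr u)

variable [Fintype Y]

open Classical in
/-- The number of answers that turn the next query into a hit. -/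
theorem card_hit_values_le {φ : Y → Z} (hφ : Function.Injective φ) {ℓ n : ℕ} (u : Z) {L : List X}
    (hL : L.length < n) (H : X → Y) :
    (Finset.univ.filter fun v : Y =>
      ∃ A ⊆ L.toFinset, A.card < ℓ ∧ φ v + ∑ z ∈ A, φ (H z) = u).card ≤ ℓ * n ^ (ℓ - 1) := by
  let F := (Finset.range ℓ).biUnion fun i => L.toFinset.powersetCard i
  have hF : F.card ≤ ℓ * n ^ (ℓ - 1) := by
    refine (Finset.card_biUnion_le_card_mul _ _ (n ^ (ℓ - 1)) fun i hi => ?_).trans (by simp)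
    rw [Finset.card_powersetCard]
    refine (Nat.choose_le_pow _ _).trans ?_
    have h1 : L.toFinset.card ≤ n := (List.toFinset_card_le L).trans hL.le
    exact (Nat.pow_le_pow_left h1 i).trans
      (Nat.pow_le_pow_right (by omega) (by have := Finset.mem_range.1 hi; omega))
  refine le_trans ?_ hF
  refine le_trans (Finset.card_le_card_of_forall_subsingleton
    (fun v A => φ v + ∑ z ∈ A, φ (H z) = u) ?_ ?_) le_rfl
  · intro v hv
    obtain ⟨A, hA, hc, hs⟩ := (Finset.mem_filter.1 hv).2
    exact ⟨A, Finset.mem_biUnion.2 ⟨A.card, Finset.mem_range.2 hc,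
      Finset.mem_powersetCard.2 ⟨hA, rfl⟩⟩, hs⟩
  · intro A _ v hv v' hv'
    exact hφ (add_right_cancel (hv.2.trans hv'.2.symm))

theorem isSupermartingale_hitSet [Nonempty Y] {φ : Y → Z} (hφ : Function.Injective φ) (ℓ n : ℕ)
    (u : Z) :
    IsSupermartingale (X := X) (Y := Y) n fun L H => 4 ^ (hitSet φ ℓ u L H).card *
      (1 + 3 * ((ℓ * n ^ (ℓ - 1) : ℕ) / (Fintype.card Y : ℝ))) ^ (n - L.length) := by
  classical
  set q : ℝ := (ℓ * n ^ (ℓ - 1) : ℕ) / (Fintype.card Y : ℝ) with hq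
  have hq0 : 0 ≤ q := by positivity
  have hY : (0 : ℝ) < Fintype.card Y := by exact_mod_cast Fintype.card_pos
  refine ⟨?_, ?_⟩
  · intro L H x hL hx
    have : hitSet φ ℓ u (x :: L) H = hitSet φ ℓ u L H := by
      rw [hitSet, if_neg]
      exact fun h => h.1 hx
    simp only [this, List.length_cons]
    exact mul_le_mul_of_nonneg_left (pow_le_pow_right₀ (by linarith) (by omega)) (by positivity)
  · intro L H x hL hx
    have hagree : ∀ v, ∀ z ∈ L, Function.update H x v z = H z := by
      intro v z hz
      rw [Function.update_of_ne]
      rintro rfl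
      exact hx hz
    set B := Finset.univ.filter fun v : Y =>
      ∃ A ⊆ L.toFinset, A.card < ℓ ∧ φ v + ∑ z ∈ A, φ (H z) = u with hB
    have hBc : (B.card : ℝ) ≤ q * Fintype.card Y := by
      rw [hq, div_mul_cancel₀ _ hY.ne']
      exact_mod_cast card_hit_values_le hφ u hL H
    have hstep : ∀ v, (4 : ℝ) ^ (hitSet φ ℓ u (x :: L) (Function.update H x v)).card ≤
        4 ^ (hitSet φ ℓ u L H).card * (1 + 3 * if v ∈ B then 1 else 0) := by
      intro v
      have hiff : (∃ A ⊆ L.toFinset, A.card < ℓ ∧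
          φ (Function.update H x v x) + ∑ z ∈ A, φ (Function.update H x v z) = u) ↔ v ∈ B := by
        rw [hB, Finset.mem_filter]
        simp only [Finset.mem_univ, true_and]
        refine exists_congr fun A => and_congr_right fun hA => ?_
        rw [sum_congr_of_agree φ (hagree v) hA, Function.update_self]
      rw [hitSet, hitSet_congr φ ℓ u L (hagree v)]
      by_cases hv : v ∈ B
      · rw [if_pos ⟨hx, hiff.2 hv⟩, if_pos hv]
        calc (4 : ℝ) ^ (insert x (hitSet φ ℓ u L H)).card
            ≤ 4 ^ ((hitSet φ ℓ u L H).card + 1) :=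
              pow_le_pow_right₀ (by norm_num) (Finset.card_insert_le _ _)
          _ = _ := by ring
      · rw [if_neg (fun h => hv (hiff.1 h.2)), if_neg hv]
        simp
    obtain ⟨m, hm⟩ : ∃ m, n - L.length = m + 1 := ⟨n - L.length - 1, by omega⟩
    have hm' : n - (x :: L).length = m := by simp only [List.length_cons]; omega
    simp only [hm, hm', ← Finset.sum_mul]
    have hsum : ∑ v : Y, (4 : ℝ) ^ (hitSet φ ℓ u (x :: L) (Function.update H x v)).card ≤
        4 ^ (hitSet φ ℓ u L H).card * (Fintype.card Y * (1 + 3 * q)) := by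
      refine (Finset.sum_le_sum fun v _ => hstep v).trans ?_
      rw [← Finset.mul_sum]
      refine mul_le_mul_of_nonneg_left ?_ (by positivity)
      rw [Finset.sum_add_distrib, ← Finset.mul_sum, Finset.sum_ite_mem]
      simp only [Finset.sum_const, Finset.card_univ, nsmul_eq_mul, mul_one, Finset.univ_inter]
      nlinarith
    calc _ ≤ 4 ^ (hitSet φ ℓ u L H).card * (Fintype.card Y * (1 + 3 * q)) * (1 + 3 * q) ^ m :=
          mul_le_mul_of_nonneg_right hsum (by positivity)
      _ = _ := by ring

/-- Among `n` adaptive queries, `r` hits are exponentially unlikely once `r` exceeds a constant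
multiple of `n ^ ℓ / |Y|`. This is a Chernoff bound, through the exponential moment of the number
of hits. -/
theorem card_hitSet_ge_le [Fintype X] [Nonempty Y] {φ : Y → Z} (hφ : Function.Injective φ) {ℓ n r : ℕ}
    (hℓ : 1 ≤ ℓ) (hr : 6 * ℓ * n ^ ℓ ≤ r * Fintype.card Y) (u : Z) {L : (X → Y) → List X}
    (hL : QueryProcess n L) :
    (Nat.card {H : X → Y // r ≤ (hitSet φ ℓ u (L H) H).card} : ℝ) ≤
      Fintype.card (X → Y) / 2 ^ r := by
  classical
  have hY : (0 : ℝ) < Fintype.card Y := by exact_mod_cast Fintype.card_pos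
  have h1 := (isSupermartingale_hitSet hφ ℓ n u).sum_le hL le_rfl
  simp only [hL.length_eq, hitSet, Nat.sub_self, pow_zero, mul_one, Finset.card_empty, one_mul,
    List.length_nil, Nat.sub_zero, Finset.sum_const, nsmul_eq_mul, Finset.card_univ] at h1
  have h2 : (1 + 3 * (((ℓ * n ^ (ℓ - 1) : ℕ) : ℝ) / (Fintype.card Y : ℝ))) ^ n ≤ 2 ^ r := by
    have hn : (n : ℝ) * (3 * (((ℓ * n ^ (ℓ - 1) : ℕ) : ℝ) / (Fintype.card Y : ℝ))) ≤ r * (1 / 2) := by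
      have e : n ^ ℓ = n ^ (ℓ - 1) * n := by rw [← pow_succ]; congr 1; omega
      have hr' : (6 * ℓ * (n ^ (ℓ - 1) * n) : ℝ) ≤ r * Fintype.card Y := by
        exact_mod_cast e ▸ hr
      rw [← mul_div_assoc, ← mul_div_assoc, div_le_iff₀ hY]
      push_cast
      linarith
    calc (1 + 3 * (((ℓ * n ^ (ℓ - 1) : ℕ) : ℝ) / (Fintype.card Y : ℝ))) ^ n
        ≤ Real.exp (3 * (((ℓ * n ^ (ℓ - 1) : ℕ) : ℝ) / (Fintype.card Y : ℝ))) ^ n := by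
          refine pow_le_pow_left₀ (by positivity) ?_ n
          rw [add_comm]
          exact Real.add_one_le_exp _
      _ = Real.exp (n * (3 * (((ℓ * n ^ (ℓ - 1) : ℕ) : ℝ) / (Fintype.card Y : ℝ)))) := by
          rw [← Real.exp_nat_mul]
      _ ≤ Real.exp (r * (1 / 2)) := Real.exp_le_exp.2 hn
      _ = Real.exp (1 / 2) ^ r := by rw [Real.exp_nat_mul]
      _ ≤ 2 ^ r := by
          refine pow_le_pow_left₀ (Real.exp_pos _).le ?_ r
          have h := Real.exp_one_lt_d9
          have h' : Real.exp (1 / 2) * Real.exp (1 / 2) = Real.exp 1 := by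
            rw [← Real.exp_add]; norm_num
          have := Real.exp_pos (1 / 2)
          nlinarith
  have h3 : (Nat.card {H : X → Y // r ≤ (hitSet φ ℓ u (L H) H).card} : ℝ) * 4 ^ r ≤
      ∑ H : X → Y, (4 : ℝ) ^ (hitSet φ ℓ u (L H) H).card := by
    rw [Nat.card_eq_fintype_card, Fintype.card_subtype, ← nsmul_eq_mul, ← Finset.sum_const]
    refine (Finset.sum_le_sum fun H hH => pow_le_pow_right₀ (by norm_num)
      (Finset.mem_filter.1 hH).2).trans ?_
    exact Finset.sum_le_sum_of_subset_of_nonneg (Finset.filter_subset _ _)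
      fun _ _ _ => by positivity
  have h4 : (Nat.card {H : X → Y // r ≤ (hitSet φ ℓ u (L H) H).card} : ℝ) * 4 ^ r ≤
      Fintype.card (X → Y) * 2 ^ r :=
    h3.trans (h1.trans (mul_le_mul_of_nonneg_left h2 (by positivity)))
  rw [le_div_iff₀ (by positivity)]
  have h5 : (4 : ℝ) ^ r = 2 ^ r * 2 ^ r := by rw [← mul_pow]; norm_num
  rw [h5, ← mul_assoc] at h4
  exact le_of_mul_le_mul_right h4 (by positivity)

theorem isSupermartingale_solutions [Nonempty Y] {φ : Y → Z} (hφ : Function.Injective φ) (j n : ℕ)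
    (u : Z) :
    IsSupermartingale (X := X) (Y := Y) n fun L H => (solutions φ (j + 1) u L H).card +
      (n - L.length : ℕ) * ((n : ℝ) ^ j / Fintype.card Y) := by
  classical
  have hY : (0 : ℝ) < Fintype.card Y := by exact_mod_cast Fintype.card_pos
  refine ⟨?_, ?_⟩
  · intro L H x hL hx
    have : solutions φ (j + 1) u (x :: L) H = solutions φ (j + 1) u L H := by
      rw [solutions, solutions, List.toFinset_cons, Finset.insert_eq_of_mem (by simpa using hx)]
    simp only [this, List.length_cons]
    gcongr
    omega
  · intro L H x hL hx
    have hagree : ∀ v, ∀ z ∈ L, Function.update H x v z = H z := by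
      intro v z hz
      rw [Function.update_of_ne]
      rintro rfl
      exact hx hz
    have hxL : x ∉ L.toFinset := by simpa using hx
    let P := L.toFinset.powersetCard j
    have hstep : ∀ v, (solutions φ (j + 1) u (x :: L) (Function.update H x v)).card ≤
        (solutions φ (j + 1) u L H).card +
          (P.filter fun B => φ v + ∑ z ∈ B, φ (H z) = u).card := by
      intro v
      rw [← solutions_congr φ (j + 1) u (hagree v)]
      rw [solutions, List.toFinset_cons, Finset.powersetCard_succ_insert hxL, Finset.filter_union]
      refine (Finset.card_union_le _ _).trans (add_le_add le_rfl ?_)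
      rw [Finset.filter_image]
      refine Finset.card_image_le.trans (le_of_eq (congrArg _ (Finset.filter_congr ?_)))
      intro B hB
      have hBL := (Finset.mem_powersetCard.1 hB).1
      rw [Finset.sum_insert (fun h => hxL (hBL h)), sum_congr_of_agree φ (hagree v) hBL,
        Function.update_self]
    have hPsum : ∑ v : Y, (P.filter fun B => φ v + ∑ z ∈ B, φ (H z) = u).card ≤ n ^ j := by
      simp only [Finset.card_filter]
      rw [Finset.sum_comm]
      simp only [← Finset.card_filter]
      calc _ ≤ ∑ B ∈ P, 1 := Finset.sum_le_sum fun B _ => Finset.card_le_one.2 fun v hv v' hv' =>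
              hφ (add_right_cancel ((Finset.mem_filter.1 hv).2.trans
                (Finset.mem_filter.1 hv').2.symm))
        _ = P.card := by simp
        _ ≤ L.toFinset.card ^ j := by
            rw [Finset.card_powersetCard]; exact Nat.choose_le_pow _ _
        _ ≤ n ^ j := Nat.pow_le_pow_left ((List.toFinset_card_le L).trans hL.le) j
    obtain ⟨m, hm⟩ : ∃ m, n - L.length = m + 1 := ⟨n - L.length - 1, by omega⟩
    have hm' : n - (x :: L).length = m := by simp only [List.length_cons]; omega
    simp only [hm, hm']
    have hsum : ∑ v : Y, ((solutions φ (j + 1) u (x :: L) (Function.update H x v)).card : ℝ) ≤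
        Fintype.card Y * (solutions φ (j + 1) u L H).card + (n : ℝ) ^ j := by
      have := (Finset.sum_le_sum fun v (_ : v ∈ Finset.univ) => hstep v)
      rw [Finset.sum_add_distrib, Finset.sum_const, smul_eq_mul, Finset.card_univ] at this
      exact_mod_cast this.trans (add_le_add le_rfl hPsum)
    rw [Finset.sum_add_distrib, Finset.sum_const, nsmul_eq_mul, Finset.card_univ]
    have e : (Fintype.card Y : ℝ) * ((n : ℝ) ^ j / Fintype.card Y) = (n : ℝ) ^ j := by
      field_simp
    push_cast
    nlinarith

/-- Among `n` adaptive queries, the expected number of solutions with `ℓ` points is at most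
`n ^ ℓ / |Y|`. -/
theorem sum_card_solutions_le [Fintype X] [Nonempty Y] {φ : Y → Z} (hφ : Function.Injective φ) {ℓ n : ℕ}
    (hℓ : 1 ≤ ℓ) (u : Z) {L : (X → Y) → List X} (hL : QueryProcess n L) :
    ∑ H : X → Y, ((solutions φ ℓ u (L H) H).card : ℝ) ≤
      Fintype.card (X → Y) * ((n : ℝ) ^ ℓ / Fintype.card Y) := by
  obtain ⟨j, rfl⟩ : ∃ j, ℓ = j + 1 := ⟨ℓ - 1, by omega⟩
  have h1 := (isSupermartingale_solutions hφ j n u).sum_le hL le_rfl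
  have h0 : ∀ H : X → Y, solutions φ (j + 1) u [] H = ∅ := fun H => by
    rw [solutions, List.toFinset_nil, Finset.powersetCard_eq_empty.2 (by simp),
      Finset.filter_empty]
  simp only [hL.length_eq, Nat.sub_self, Nat.cast_zero, zero_mul, add_zero, List.length_nil,
    Nat.sub_zero, h0, Finset.card_empty, zero_add, Finset.sum_const, nsmul_eq_mul,
    Finset.card_univ] at h1
  refine h1.trans (le_of_eq ?_)
  rw [pow_succ]
  ring

end Solutions

/-! ### Collisions among adaptively queried points -/

section Collisions

variable {X Y : Type*}

/-- Two different points of `L` in `V` have the same value. -/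
def HasCollision (V : Finset X) (L : List X) (G : X → Y) : Prop :=
  ∃ z ∈ L, ∃ z' ∈ L, z ∈ V ∧ z' ∈ V ∧ z ≠ z' ∧ G z = G z'

theorem hasCollision_congr (V : Finset X) {L : List X} {G G' : X → Y} (h : ∀ x ∈ L, G' x = G x) :
    HasCollision V L G' ↔ HasCollision V L G := by
  refine exists_congr fun z => and_congr_right fun hz => exists_congr fun z' =>
    and_congr_right fun hz' => ?_
  rw [h z hz, h z' hz']

variable [DecidableEq X] [Fintype Y]

open Classical in
theorem isSupermartingale_collision [Nonempty Y] (V : Finset X) (k n : ℕ) :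
    IsSupermartingale (X := X) (Y := Y) n fun L G =>
      if (L.toFinset ∩ V).card ≤ k then
        (if HasCollision V L G then 1 else 0) +
          ((k : ℝ) - (L.toFinset ∩ V).card) * (k / Fintype.card Y)
      else 0 := by
  have hY : (0 : ℝ) < Fintype.card Y := by exact_mod_cast Fintype.card_pos
  refine ⟨?_, ?_⟩
  · intro L G x _ hx
    have h1 : (x :: L).toFinset = L.toFinset := by
      rw [List.toFinset_cons, Finset.insert_eq_of_mem (by simpa using hx)]
    have h2 : HasCollision V (x :: L) G ↔ HasCollision V L G := by
      have : ∀ z, z ∈ x :: L ↔ z ∈ L := by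
        intro z
        simp only [List.mem_cons, or_iff_right_iff_imp]
        rintro rfl
        exact hx
      simp only [HasCollision, this]
    simp only [h1, h2]
    exact le_rfl
  · intro L G x _ hx
    have hagree : ∀ v, ∀ z ∈ L, Function.update G x v z = G z := by
      intro v z hz
      rw [Function.update_of_ne]
      rintro rfl
      exact hx hz
    by_cases hxV : x ∈ V
    · have hcard : ((x :: L).toFinset ∩ V).card = (L.toFinset ∩ V).card + 1 := by
        rw [List.toFinset_cons, Finset.insert_inter_of_mem hxV, Finset.card_insert_of_notMem]
        simp [hx]
      rw [hcard]
      set c := (L.toFinset ∩ V).card with hc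
      by_cases hck : c + 1 ≤ k
      · simp only [if_pos hck, if_pos (show c ≤ k by omega)]
        -- a new collision requires the new value to be among the `c` values already seen
        have hstep : ∀ v, (if HasCollision V (x :: L) (Function.update G x v) then (1 : ℝ) else 0) ≤
            (if HasCollision V L G then 1 else 0) +
              if v ∈ (L.toFinset ∩ V).image G then 1 else 0 := by
          intro v
          by_cases h1 : HasCollision V (x :: L) (Function.update G x v)
          · by_cases h2 : HasCollision V L G
            · rw [if_pos h1, if_pos h2]
              split_ifs <;> norm_num
            · have h3 : v ∈ (L.toFinset ∩ V).image G := by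
                obtain ⟨z, hz, z', hz', hzV, hzV', hne, heq⟩ := h1
                rcases List.mem_cons.1 hz with rfl | hzL
                · have hzL' : z' ∈ L := (List.mem_cons.1 hz').resolve_left (Ne.symm hne)
                  rw [Function.update_self, hagree v z' hzL'] at heq
                  exact Finset.mem_image.2 ⟨z', by simp [hzL', hzV'], heq.symm⟩
                · rcases List.mem_cons.1 hz' with rfl | hzL'
                  · rw [Function.update_self, hagree v z hzL] at heq
                    exact Finset.mem_image.2 ⟨z, by simp [hzL, hzV], heq⟩
                  · rw [hagree v z hzL, hagree v z' hzL'] at heq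
                    exact absurd ⟨z, hzL, z', hzL', hzV, hzV', hne, heq⟩ h2
              rw [if_pos h1, if_neg h2, if_pos h3]
              norm_num
          · rw [if_neg h1]
            positivity
        have hsum := Finset.sum_le_sum fun v (_ : v ∈ Finset.univ) => hstep v
        rw [Finset.sum_add_distrib, Finset.sum_ite_mem] at hsum
        simp only [Finset.univ_inter, Finset.sum_const, nsmul_eq_mul, Finset.card_univ,
          mul_one] at hsum
        have him : (((L.toFinset ∩ V).image G).card : ℝ) ≤ k := by
          exact_mod_cast Finset.card_image_le.trans (by omega : c ≤ k)
        rw [Finset.sum_add_distrib, Finset.sum_const, nsmul_eq_mul, Finset.card_univ]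
        have e : (Fintype.card Y : ℝ) * ((k : ℝ) / Fintype.card Y) = k := by field_simp
        push_cast
        nlinarith
      · simp only [if_neg hck, Finset.sum_const_zero]
        refine mul_nonneg hY.le ?_
        split_ifs with h1 h2
        · have : (c : ℝ) ≤ k := by exact_mod_cast h1
          have : 0 ≤ ((k : ℝ) - c) * (k / Fintype.card Y) :=
            mul_nonneg (by linarith) (by positivity)
          linarith
        · have : (c : ℝ) ≤ k := by exact_mod_cast h1
          have : 0 ≤ ((k : ℝ) - c) * (k / Fintype.card Y) :=
            mul_nonneg (by linarith) (by positivity)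
          linarith
        · exact le_rfl
    · have hcard : (x :: L).toFinset ∩ V = L.toFinset ∩ V := by
        rw [List.toFinset_cons, Finset.insert_inter_of_notMem hxV]
      have hcoll : ∀ v, HasCollision V (x :: L) (Function.update G x v) ↔ HasCollision V L G := by
        intro v
        rw [← hasCollision_congr V (hagree v)]
        constructor
        · rintro ⟨z, hz, z', hz', hzV, hzV', h⟩
          have hne : ∀ w ∈ V, w ≠ x := by
            rintro w hw rfl
            exact hxV hw
          exact ⟨z, (List.mem_cons.1 hz).resolve_left (hne z hzV), z',
            (List.mem_cons.1 hz').resolve_left (hne z' hzV'), hzV, hzV', h⟩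
        · rintro ⟨z, hz, z', hz', h⟩
          exact ⟨z, List.mem_cons_of_mem _ hz, z', List.mem_cons_of_mem _ hz', h⟩
      simp only [hcard, hcoll, Finset.sum_const, nsmul_eq_mul, Finset.card_univ]
      exact le_rfl

/-- The birthday bound for adaptive queries: however many queries are made, a collision within the
first `k` points of `V` that are queried has probability at most `k ^ 2 / |Y|`. -/
theorem card_hasCollision_le [Fintype X] [Nonempty Y] (V : Finset X) (k : ℕ) {n : ℕ} {L : (X → Y) → List X}
    (hL : QueryProcess n L) :
    (Nat.card {G : X → Y // ((L G).toFinset ∩ V).card ≤ k ∧ HasCollision V (L G) G} : ℝ) ≤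
      Fintype.card (X → Y) * ((k : ℝ) ^ 2 / Fintype.card Y) := by
  classical
  have h1 := (isSupermartingale_collision V k n).sum_le hL le_rfl
  have h0 : ¬ ∃ G : X → Y, HasCollision V [] G := by simp [HasCollision]
  simp only [List.toFinset_nil, Finset.empty_inter, Finset.card_empty, Nat.zero_le, if_true,
    Nat.cast_zero, sub_zero, not_exists.1 h0, if_false, zero_add, Finset.sum_const, nsmul_eq_mul,
    Finset.card_univ] at h1
  rw [Nat.card_eq_fintype_card, Fintype.card_subtype, Finset.card_filter]
  push_cast
  refine le_trans (Finset.sum_le_sum fun G _ => ?_) (h1.trans (le_of_eq (by ring)))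
  by_cases hk : ((L G).toFinset ∩ V).card ≤ k
  · have : (((L G).toFinset ∩ V).card : ℝ) ≤ k := by exact_mod_cast hk
    have : 0 ≤ ((k : ℝ) - ((L G).toFinset ∩ V).card) * (k / Fintype.card Y) :=
      mul_nonneg (by linarith) (by positivity)
    simp only [hk, true_and, if_true]
    linarith
  · simp [hk]

end Collisions

/-! ### Query histories of an algorithm -/

section Histories

variable {ℓ M N N₀ S : ℕ}

/-- Values of the oracle `H` as residues modulo `N`. -/
def residue (N : ℕ) (a : Fin N) : ZMod N := ((a : ℕ) : ZMod N)

theorem residue_injective (N : ℕ) : Function.Injective (residue N) := by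
  intro a b h
  have := (ZMod.natCast_eq_natCast_iff _ _ _).1 h
  exact Fin.ext (by rwa [Nat.ModEq, Nat.mod_eq_of_lt a.2, Nat.mod_eq_of_lt b.2] at this)

theorem sum_residue_eq_iff {ι : Type*} (s : Finset ι) (f : ι → Fin N) (y : Fin N) :
    ∑ i ∈ s, residue N (f i) = residue N y ↔ (∑ i ∈ s, (f i : ℕ)) ≡ (y : ℕ) [MOD N] := by
  simp only [residue]
  rw [← Nat.cast_sum, ZMod.natCast_eq_natCast_iff]

open Classical in
/-- The increasing tuples whose `H`-sum is `y` modulo `N`. -/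
noncomputable def validTuples (H : Fin M → Fin N) (y : Fin N) : Finset (Tuple ℓ M) :=
  {x | StrictMono x ∧ (∑ i, (H (x i) : ℕ)) ≡ (y : ℕ) [MOD N]}

theorem mem_validTuples {H : Fin M → Fin N} {y : Fin N} {x : Tuple ℓ M} :
    x ∈ validTuples H y ↔ StrictMono x ∧ (∑ i, (H (x i) : ℕ)) ≡ (y : ℕ) [MOD N] := by
  simp [validTuples]

/-- The set of entries of a valid tuple is a solution, and it determines the tuple. -/
theorem card_validTuples_le_card_solutions (H : Fin M → Fin N) (y : Fin N) (L : List (Fin M))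
    (V : Finset (Tuple ℓ M)) (hV : V ⊆ validTuples H y) (hL : ∀ x ∈ V, ∀ i, x i ∈ L) :
    V.card ≤ (solutions (residue N) ℓ (residue N y) L H).card := by
  classical
  refine Finset.card_le_card_of_injOn (fun x => Finset.univ.image x) ?_ ?_
  · intro x hx
    obtain ⟨hmono, hsum⟩ := mem_validTuples.1 (hV hx)
    refine Finset.mem_coe.2 (Finset.mem_filter.2 ⟨Finset.mem_powersetCard.2 ⟨?_, ?_⟩, ?_⟩)
    · intro z hz
      obtain ⟨i, -, rfl⟩ := Finset.mem_image.1 hz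
      simpa using hL x hx i
    · rw [Finset.card_image_of_injective _ hmono.injective]
      simp
    · rw [Finset.sum_image hmono.injective.injOn]
      exact (sum_residue_eq_iff _ _ _).2 hsum
  · intro x hx x' hx' h
    have h1 := (mem_validTuples.1 (hV hx)).1
    have h2 := (mem_validTuples.1 (hV hx')).1
    refine (StrictMono.range_inj h1 h2).1 ?_
    have := congrArg (fun s : Finset (Fin M) => (s : Set (Fin M))) h
    simpa using this

/-- A query, read as a tuple: a query of the point `x` becomes the constant tuple at `x`, which
is not increasing. In this way a query always touches all the points of a tuple in `H`, and one
tuple in `G`. -/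
def queryTuple : Fin M ⊕ Tuple ℓ M → Tuple ℓ M := Sum.elim (fun x _ => x) id

namespace DetAlgorithm

variable (P : DetAlgorithm ℓ M N N₀ S) (H : Fin M → Fin N) (G : Tuple ℓ M → Fin N₀) (y : Fin N)

/-- The memory `t` queries after time `t₀`, when it is `m` at time `t₀`. -/
def run (t₀ : ℕ) (m : Memory S) : ℕ → Memory S
  | 0 => m
  | t + 1 => P.update y (t₀ + t) (run t₀ m t) (Sum.map H G (P.query y (t₀ + t) (run t₀ m t)))

/-- The query made `t` queries after time `t₀`, read as a tuple. -/
def nextTuple (t₀ : ℕ) (m : Memory S) (t : ℕ) : Tuple ℓ M :=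
  queryTuple (P.query y (t₀ + t) (P.run H G y t₀ m t))

/-- The points touched by the `t` queries that follow time `t₀`. -/
def pointHistory (t₀ : ℕ) (m : Memory S) : ℕ → List (Fin M)
  | 0 => []
  | t + 1 => List.ofFn (P.nextTuple H G y t₀ m t) ++ pointHistory t₀ m t

/-- The first `t` queries, read as tuples. -/
def tupleHistory : ℕ → List (Tuple ℓ M)
  | 0 => []
  | t + 1 => P.nextTuple H G y 0 (P.init y) t :: tupleHistory t

theorem run_zero_init (t : ℕ) : P.run H G y 0 (P.init y) t = P.memoryAfter H G y t := by
  induction t with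
  | zero => rfl
  | succ t ih => simp only [run, memoryAfter, ih, Nat.zero_add]

theorem run_memoryAfter (t₀ t : ℕ) :
    P.run H G y t₀ (P.memoryAfter H G y t₀) t = P.memoryAfter H G y (t₀ + t) := by
  induction t with
  | zero => rfl
  | succ t ih => rw [run, ih]; rfl

theorem mem_tupleHistory {t : ℕ} {z : Tuple ℓ M} (hz : z ∈ P.tupleHistory H G y t) :
    ∃ i < t, z = queryTuple (P.query y i (P.memoryAfter H G y i)) := by
  induction t with
  | zero => simp [tupleHistory] at hz
  | succ t ih =>
    rcases List.mem_cons.1 hz with rfl | hz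
    · exact ⟨t, Nat.lt_succ_self t, by rw [nextTuple, run_zero_init, Nat.zero_add]⟩
    · obtain ⟨i, hi, h⟩ := ih hz
      exact ⟨i, hi.trans (Nat.lt_succ_self t), h⟩

theorem mem_pointHistory {t₀ t j : ℕ} (m : Memory S) (hj : j < t) (i : Fin ℓ) :
    P.nextTuple H G y t₀ m j i ∈ P.pointHistory H G y t₀ m t := by
  induction t with
  | zero => omega
  | succ t ih =>
    rw [pointHistory, List.mem_append]
    rcases Nat.lt_succ_iff_lt_or_eq.1 hj with h | rfl
    · exact Or.inr (ih h)
    · exact Or.inl (by simp [List.mem_ofFn])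

variable {H}

theorem queryProcess_pointHistory (hℓ : 1 ≤ ℓ) (t₀ : ℕ) (m : Memory S) (t : ℕ) :
    QueryProcess (ℓ * t) (fun H => P.pointHistory H G y t₀ m t) ∧
      DeterminedBy (fun H => P.pointHistory H G y t₀ m t) (fun H => P.run H G y t₀ m t) := by
  induction t with
  | zero => exact ⟨QueryProcess.nil, fun _ _ _ => rfl⟩
  | succ t ih =>
    obtain ⟨h1, h2⟩ := ih
    refine ⟨h1.append_ofFn (fun H => P.nextTuple H G y t₀ m t)
      (h2.comp fun μ => queryTuple (P.query y (t₀ + t) μ)), fun H H' hH => ?_⟩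
    have e : P.run H' G y t₀ m t = P.run H G y t₀ m t :=
      h2 H H' fun x hx => hH x (List.mem_append_right _ hx)
    simp only [run, e]
    congr 1
    have hq : ∀ i, H' (P.nextTuple H G y t₀ m t i) = H (P.nextTuple H G y t₀ m t i) := fun i =>
      hH _ (List.mem_append_left _ (by simp [List.mem_ofFn]))
    rcases hx : P.query y (t₀ + t) (P.run H G y t₀ m t) with x | z
    · have := hq ⟨0, hℓ⟩
      simp only [nextTuple, hx, queryTuple, Sum.elim_inl] at this
      simp [this]
    · rfl

variable (H) in
theorem queryProcess_tupleHistory (t : ℕ) :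
    QueryProcess t (fun G => P.tupleHistory H G y t) ∧
      DeterminedBy (fun G => P.tupleHistory H G y t) (fun G => P.memoryAfter H G y t) := by
  induction t with
  | zero => exact ⟨QueryProcess.nil, fun _ _ _ => rfl⟩
  | succ t ih =>
    obtain ⟨h1, h2⟩ := ih
    have h3 : ∀ G, P.nextTuple H G y 0 (P.init y) t =
        queryTuple (P.query y t (P.memoryAfter H G y t)) := fun G => by
      rw [nextTuple, run_zero_init, Nat.zero_add]
    have h4 : DeterminedBy (fun G => P.tupleHistory H G y t)
        fun G => P.nextTuple H G y 0 (P.init y) t := by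
      simp only [h3]
      exact h2.comp fun μ => queryTuple (P.query y t μ)
    refine ⟨h1.cons h4, fun G G' hG => ?_⟩
    have e : P.memoryAfter H G' y t = P.memoryAfter H G y t :=
      h2 G G' fun x hx => hG x (List.mem_cons_of_mem _ hx)
    simp only [memoryAfter, e]
    congr 1
    have hq := hG _ (List.mem_cons_self (a := P.nextTuple H G y 0 (P.init y) t)
      (l := P.tupleHistory H G y t))
    rw [h3] at hq
    rcases hx : P.query y t (P.memoryAfter H G y t) with x | z
    · rfl
    · simp only [hx, queryTuple, Sum.elim_inr, id] at hq
      simp [hq]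

end DetAlgorithm

end Histories

/-! ### Bounds on the winning probability -/

section WinProb

variable {ℓ M N N₀ S : ℕ} (P : DetAlgorithm ℓ M N N₀ S)

open Classical in
/-- If, outside an event of probability at most `β`, at most `k` valid tuples are queried, then the
algorithm wins with probability at most `β + (k + 2) ^ 2 / N₀`: the two tuples in the output add at
most two to the number of valid tuples, and the collision has to be found by luck. -/
theorem DetAlgorithm.winProb_le (T : ℕ) (y : Fin N) (hN₀ : 0 < N₀)
    (bad : (Fin M → Fin N) → (Tuple ℓ M → Fin N₀) → Prop) (β : ℝ) (k : ℕ)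
    (hbad : ∀ G, (Nat.card {H // bad H G} : ℝ) ≤ Fintype.card (Fin M → Fin N) * β)
    (hk : ∀ H G, ¬ bad H G → ((P.tupleHistory H G y T).toFinset ∩ validTuples H y).card ≤ k) :
    P.winProb T y ≤ ENNReal.ofReal (β + ((k : ℝ) + 2) ^ 2 / N₀) := by
  have : Nonempty (Fin N₀) := ⟨⟨0, hN₀⟩⟩
  have : Nonempty (Fin N) := ⟨y⟩
  let out := fun H G => P.output y (P.memoryAfter H G y T)
  let full := fun H G => (out H G).1 :: (out H G).2 :: P.tupleHistory H G y T
  have hfull : ∀ H, QueryProcess (T + 2) (full H) := fun H => by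
    obtain ⟨h1, h2⟩ := P.queryProcess_tupleHistory H y T
    have h3 := h1.cons (h2.comp fun μ => (P.output y μ).2)
    exact h3.cons ((h2.comp fun μ => (P.output y μ).1).mono fun G => List.subset_cons_self _ _)
  have hwin : ∀ H G, P.Wins T H G y → ¬ bad H G →
      ((full H G).toFinset ∩ validTuples H y).card ≤ k + 2 ∧
        HasCollision (validTuples H y) (full H G) G := by
    intro H G hw hb
    constructor
    · have : (full H G).toFinset ∩ validTuples H y ⊆ insert (out H G).1 (insert (out H G).2
          ((P.tupleHistory H G y T).toFinset ∩ validTuples H y)) := by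
        intro z hz
        simp only [full, List.toFinset_cons, Finset.mem_inter, Finset.mem_insert] at hz ⊢
        tauto
      refine (Finset.card_le_card this).trans ((Finset.card_insert_le _ _).trans ?_)
      have := Finset.card_insert_le (out H G).2
        ((P.tupleHistory H G y T).toFinset ∩ validTuples H y)
      have := hk H G hb
      omega
    · obtain ⟨hne, hm, hm', hs, hs', hG⟩ := hw
      exact ⟨(out H G).1, by simp [full], (out H G).2, by simp [full],
        mem_validTuples.2 ⟨hm, hs⟩, mem_validTuples.2 ⟨hm', hs'⟩, hne, hG⟩
  have hcard : (Nat.card {O : (Fin M → Fin N) × (Tuple ℓ M → Fin N₀) // P.Wins T O.1 O.2 y} : ℝ) ≤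
      (β + ((k : ℝ) + 2) ^ 2 / N₀) * Nat.card ((Fin M → Fin N) × (Tuple ℓ M → Fin N₀)) := by
    have e1 : (Nat.card {O : (Fin M → Fin N) × (Tuple ℓ M → Fin N₀) //
        P.Wins T O.1 O.2 y} : ℝ) = ∑ H, ∑ G, if P.Wins T H G y then (1 : ℝ) else 0 := by
      rw [Nat.card_eq_fintype_card, Fintype.card_subtype, Finset.card_filter,
        ← Fintype.sum_prod_type' fun H G => if P.Wins T H G y then (1 : ℝ) else 0]
      push_cast
      rfl
    have e2 : ∀ G, (Nat.card {H // bad H G} : ℝ) = ∑ H, if bad H G then (1 : ℝ) else 0 := by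
      intro G
      rw [Nat.card_eq_fintype_card, Fintype.card_subtype, Finset.card_filter]
      push_cast
      rfl
    let C := fun H G => ((full H G).toFinset ∩ validTuples H y).card ≤ k + 2 ∧
        HasCollision (validTuples H y) (full H G) G
    have e3 : ∀ H, (Nat.card {G // C H G} : ℝ) = ∑ G, if C H G then (1 : ℝ) else 0 := by
      intro H
      rw [Nat.card_eq_fintype_card, Fintype.card_subtype, Finset.card_filter]
      push_cast
      rfl
    have hC : ∀ H, (Nat.card {G // C H G} : ℝ) ≤
        Fintype.card (Tuple ℓ M → Fin N₀) * (((k : ℝ) + 2) ^ 2 / N₀) := by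
      intro H
      have := card_hasCollision_le (validTuples H y) (k + 2) (hfull H)
      simpa using this
    calc (Nat.card {O : (Fin M → Fin N) × (Tuple ℓ M → Fin N₀) // P.Wins T O.1 O.2 y} : ℝ)
        ≤ ∑ H, ∑ G, ((if bad H G then (1 : ℝ) else 0) + if C H G then (1 : ℝ) else 0) := by
          rw [e1]
          refine Finset.sum_le_sum fun H _ => Finset.sum_le_sum fun G _ => ?_
          by_cases hb : bad H G
          · rw [if_pos hb]
            split_ifs <;> norm_num
          · by_cases hw : P.Wins T H G y
            · rw [if_pos hw, if_neg hb, if_pos (hwin H G hw hb)]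
              norm_num
            · rw [if_neg hw]
              positivity
      _ = ∑ G, (Nat.card {H // bad H G} : ℝ) + ∑ H, (Nat.card {G // C H G} : ℝ) := by
          simp only [Finset.sum_add_distrib, e2, e3]
          rw [Finset.sum_comm]
      _ ≤ ∑ _G : Tuple ℓ M → Fin N₀, Fintype.card (Fin M → Fin N) * β +
          ∑ _H : Fin M → Fin N,
            Fintype.card (Tuple ℓ M → Fin N₀) * (((k : ℝ) + 2) ^ 2 / N₀) :=
          add_le_add (Finset.sum_le_sum fun G _ => hbad G) (Finset.sum_le_sum fun H _ => hC H)
      _ = _ := by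
          rw [Nat.card_prod, Nat.card_eq_fintype_card, Nat.card_eq_fintype_card]
          simp only [Finset.sum_const, nsmul_eq_mul, Finset.card_univ]
          push_cast
          ring
  have hpos : (Nat.card ((Fin M → Fin N) × (Tuple ℓ M → Fin N₀)) : ℝ≥0∞) ≠ 0 := by
    exact_mod_cast Nat.card_pos.ne'
  rw [DetAlgorithm.winProb, ENNReal.div_le_iff_le_mul (Or.inl hpos)
    (Or.inl (ENNReal.natCast_ne_top _)), ← ENNReal.ofReal_natCast, ← ENNReal.ofReal_natCast,
    ← ENNReal.ofReal_mul' (by positivity)]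
  exact ENNReal.ofReal_le_ofReal hcard

/-- Bound for an algorithm with unbounded memory, by Markov's inequality for the number of
solutions. -/
theorem DetAlgorithm.winProb_le_of_queries (T : ℕ) (y : Fin N) (hℓ : 1 ≤ ℓ) (hN₀ : 0 < N₀)
    {k : ℕ} (hk : 1 ≤ k) :
    P.winProb T y ≤ ENNReal.ofReal (((ℓ * T : ℕ) : ℝ) ^ ℓ / N / k + ((k : ℝ) + 2) ^ 2 / N₀) := by
  classical
  have : Nonempty (Fin N) := ⟨y⟩
  let L := fun H G => P.pointHistory H G y 0 (P.init y) T
  refine P.winProb_le T y hN₀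
    (fun H G => k ≤ (solutions (residue N) ℓ (residue N y) (L H G) H).card) _ k ?_ ?_
  · intro G
    have h1 := sum_card_solutions_le (residue_injective N) hℓ (residue N y)
      (P.queryProcess_pointHistory G y hℓ 0 (P.init y) T).1
    have h2 : (Nat.card {H // k ≤ (solutions (residue N) ℓ (residue N y) (L H G) H).card} : ℝ) * k ≤
        ∑ H, ((solutions (residue N) ℓ (residue N y) (L H G) H).card : ℝ) := by
      rw [Nat.card_eq_fintype_card, Fintype.card_subtype, ← nsmul_eq_mul, ← Finset.sum_const]
      refine (Finset.sum_le_sum fun H hH => Nat.cast_le.2 (Finset.mem_filter.1 hH).2).trans ?_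
      exact Finset.sum_le_sum_of_subset_of_nonneg (Finset.filter_subset _ _)
        fun _ _ _ => by positivity
    have hk' : (0 : ℝ) < k := by exact_mod_cast hk
    rw [← mul_div_assoc, le_div_iff₀ hk']
    simpa using h2.trans h1
  · intro H G hb
    refine le_trans ?_ (not_le.1 hb).le
    refine card_validTuples_le_card_solutions H y _ _ Finset.inter_subset_right ?_
    intro x hx i
    obtain ⟨j, hj, rfl⟩ := P.mem_tupleHistory H G y
      (List.mem_toFinset.1 (Finset.mem_inter.1 hx).1)
    have := P.mem_pointHistory H G y (t₀ := 0) (P.init y) hj i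
    rwa [nextTuple, run_zero_init, Nat.zero_add] at this

/-- Bound for an algorithm with `S` bits of memory. The queries are cut into `n` blocks of `τ`
queries. Whatever the memory at the beginning of a block, the block sees at most `r` hits for every
sum, hence at most `r ^ ℓ` valid tuples, except with probability `2 ^ (-r)`; the union bound is
over the blocks, the contents of the memory and the sums. -/
theorem DetAlgorithm.winProb_le_of_memory (T : ℕ) (y : Fin N) (hℓ : 1 ≤ ℓ) (hN₀ : 0 < N₀)
    {n τ r : ℕ} (hτ : 1 ≤ τ) (hT : T ≤ n * τ) (hr : 6 * ℓ * (ℓ * τ) ^ ℓ ≤ r * N) :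
    P.winProb T y ≤
      ENNReal.ofReal ((n * 2 ^ S * N : ℝ) / 2 ^ r + (((n * r ^ ℓ : ℕ) : ℝ) + 2) ^ 2 / N₀) := by
  classical
  have : Nonempty (Fin N) := ⟨y⟩
  have : NeZero N := ⟨fun h => by subst h; exact y.elim0⟩
  let L := fun (H : Fin M → Fin N) (G : Tuple ℓ M → Fin N₀) (s : ℕ) (m : Memory S) =>
    P.pointHistory H G y (s * τ) m τ
  refine P.winProb_le T y hN₀ (fun H G => ∃ c : Fin n × Memory S × ZMod N,
    r ≤ (hitSet (residue N) ℓ c.2.2 (L H G c.1 c.2.1) H).card) _ (n * r ^ ℓ) ?_ ?_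
  · intro G
    have h1 : ∀ c : Fin n × Memory S × ZMod N,
        (Nat.card {H // r ≤ (hitSet (residue N) ℓ c.2.2 (L H G c.1 c.2.1) H).card} : ℝ) ≤
          Fintype.card (Fin M → Fin N) / 2 ^ r := fun c =>
      card_hitSet_ge_le (residue_injective N) hℓ (by simpa using hr) c.2.2
        (P.queryProcess_pointHistory G y hℓ (c.1 * τ) c.2.1 τ).1
    simp only [Nat.card_eq_fintype_card, Fintype.card_subtype] at h1 ⊢
    have h2 : (Finset.univ.filter fun H : Fin M → Fin N => ∃ c : Fin n × Memory S × ZMod N,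
        r ≤ (hitSet (residue N) ℓ c.2.2 (L H G c.1 c.2.1) H).card) ⊆
        Finset.univ.biUnion fun c : Fin n × Memory S × ZMod N => Finset.univ.filter fun H =>
          r ≤ (hitSet (residue N) ℓ c.2.2 (L H G c.1 c.2.1) H).card := by
      intro H hH
      simpa using hH
    calc _ ≤ ∑ c : Fin n × Memory S × ZMod N, ((Finset.univ.filter fun H : Fin M → Fin N =>
          r ≤ (hitSet (residue N) ℓ c.2.2 (L H G c.1 c.2.1) H).card).card : ℝ) := by
          exact_mod_cast (Finset.card_le_card h2).trans Finset.card_biUnion_le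
      _ ≤ ∑ _c : Fin n × Memory S × ZMod N, (Fintype.card (Fin M → Fin N) : ℝ) / 2 ^ r :=
          Finset.sum_le_sum fun c _ => h1 c
      _ = _ := by
          simp only [Finset.sum_const, nsmul_eq_mul, Finset.card_univ, Fintype.card_prod,
            Fintype.card_fin, Fintype.card_fun, Fintype.card_bool, ZMod.card]
          push_cast
          ring
  · intro H G hb
    have hb' : ∀ (s : Fin n) (m : Memory S) (u : ZMod N),
        (hitSet (residue N) ℓ u (L H G s m) H).card ≤ r := fun s m u => by
      by_contra h
      exact hb ⟨(s, m, u), (not_le.1 h).le⟩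
    let W := fun s : Fin n => (P.tupleHistory H G y T).toFinset ∩ validTuples H y |>.filter
      fun x => ∀ i, x i ∈ L H G s (P.memoryAfter H G y (s * τ))
    have hsub : (P.tupleHistory H G y T).toFinset ∩ validTuples H y ⊆ Finset.univ.biUnion W := by
      intro x hx
      obtain ⟨j, hj, hxj⟩ := P.mem_tupleHistory H G y
        (List.mem_toFinset.1 (Finset.mem_inter.1 hx).1)
      have hs : j / τ < n := Nat.div_lt_of_lt_mul (by rw [mul_comm]; omega)
      refine Finset.mem_biUnion.2 ⟨⟨j / τ, hs⟩, Finset.mem_univ _,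
        Finset.mem_filter.2 ⟨hx, fun i => ?_⟩⟩
      have := P.mem_pointHistory H G y (t₀ := j / τ * τ) (P.memoryAfter H G y (j / τ * τ))
        (Nat.mod_lt j hτ) i
      rw [nextTuple, run_memoryAfter, Nat.div_add_mod'] at this
      rw [hxj]
      exact this
    calc _ ≤ ∑ s, (W s).card := (Finset.card_le_card hsub).trans Finset.card_biUnion_le
      _ ≤ ∑ _s : Fin n, r ^ ℓ := Finset.sum_le_sum fun s _ =>
          (card_validTuples_le_card_solutions H y _ (W s)
            ((Finset.filter_subset _ _).trans Finset.inter_subset_right)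
            fun x hx => (Finset.mem_filter.1 hx).2).trans
            (card_solutions_le _ (fun u => hb' s _ u) le_rfl _)
      _ = n * r ^ ℓ := by simp

/-- A bound on the winning probability of all deterministic algorithms on all targets bounds the
success probability of all randomized ones. -/
theorem successProb_le {q : ℝ≥0∞} (A : RandAlgorithm ℓ M N N₀ S) (D : PMF (Fin N)) (T : ℕ)
    (h : ∀ (P : DetAlgorithm ℓ M N N₀ S) (y : Fin N), P.winProb T y ≤ q) :
    successProb A D T ≤ q := by
  have hD : ∑ y, D y = 1 := by rw [← tsum_fintype (L := .unconditional _)]; exact D.tsum_coe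
  calc successProb A D T ≤ ∑' P, A P * q := by
        refine ENNReal.tsum_le_tsum fun P => mul_le_mul_right ?_ _
        calc ∑ y, D y * P.winProb T y ≤ ∑ y, D y * q :=
              Finset.sum_le_sum fun y _ => mul_le_mul_right (h P y) _
          _ = q := by rw [← Finset.sum_mul, hD, one_mul]
    _ = q := by rw [ENNReal.tsum_mul_right, A.tsum_coe, one_mul]

end WinProb

/-! ### Asymptotic lower bounds -/

section LowerBounds

theorem eventually_le_natCast_rpow (B : ℝ) {s : ℝ} (hs : 0 < s) :
    ∀ᶠ N : ℕ in atTop, B ≤ (N : ℝ) ^ s :=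
  ((tendsto_rpow_atTop hs).comp tendsto_natCast_atTop_atTop).eventually_ge_atTop B

theorem eventually_mul_log_le_rpow (B : ℝ) {s : ℝ} (hs : 0 < s) :
    ∀ᶠ N : ℕ in atTop, B * Real.log N ≤ (N : ℝ) ^ s := by
  have h := ((isLittleO_log_rpow_atTop hs).const_mul_left B).comp_tendsto
    tendsto_natCast_atTop_atTop
  filter_upwards [h.bound one_pos] with N hN
  have h2 : (0 : ℝ) ≤ (N : ℝ) ^ s := by positivity
  simp only [Function.comp_apply, one_mul, Real.norm_eq_abs, abs_of_nonneg h2] at hN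
  exact (le_abs_self _).trans hN

theorem rpow_one_div_pow {ℓ : ℕ} (hℓ : 1 ≤ ℓ) {x : ℝ} (hx : 0 ≤ x) :
    (x ^ (1 / (ℓ : ℝ))) ^ ℓ = x := by
  rw [one_div, Real.rpow_inv_natCast_pow hx (by omega)]

theorem rpow_queries_pow {ℓ : ℕ} (hℓ : 1 ≤ ℓ) (ε : ℝ) {x : ℝ} (hx : 0 < x) :
    (x ^ (1 / (ℓ : ℝ) + ε / (2 * (ℓ : ℝ)))) ^ ℓ = x * x ^ (ε / 2) := by
  have hℓ' : (0 : ℝ) < ℓ := by exact_mod_cast hℓ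
  have h : (1 / (ℓ : ℝ) + ε / (2 * (ℓ : ℝ))) * ℓ = 1 + ε / 2 := by field_simp
  rw [← Real.rpow_natCast, ← Real.rpow_mul hx.le, h, Real.rpow_add hx, Real.rpow_one]

theorem rpow_half_sq {x : ℝ} (hx : 0 ≤ x) (ε : ℝ) : (x ^ (ε / 2)) ^ 2 = x ^ ε := by
  rw [← Real.rpow_natCast, ← Real.rpow_mul hx]
  congr 1
  push_cast
  ring

/-- The lower bound that holds for unbounded space. -/
theorem queries_lower_bound {ℓ : ℕ} {ε c₁ : ℝ} {N₀ : ℕ → ℕ} (hℓ : 1 ≤ ℓ) (hε : 0 < ε)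
    (hc₁ : 0 < c₁) (hN₀ : ∀ᶠ N : ℕ in atTop, c₁ * (N : ℝ) ^ ε ≤ N₀ N) {p : ℝ} (hp : 0 < p) :
    ∃ c : ℝ, 0 < c ∧ ∀ᶠ N : ℕ in atTop,
      ∀ (M S T : ℕ) (D : PMF (Fin N)) (A : RandAlgorithm ℓ M N (N₀ N) S),
        ENNReal.ofReal p ≤ successProb A D T →
        c * (N : ℝ) ^ (1 / (ℓ : ℝ) + ε / (2 * (ℓ : ℝ))) ≤ T := by
  have hℓ' : (0 : ℝ) < ℓ := by exact_mod_cast hℓ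
  -- about `η * N ^ (ε / 2)` valid tuples are needed for a collision among their `G`-values
  set η : ℝ := √(p * c₁) / 4 with hη
  have hη0 : 0 < η := by positivity
  have hη2 : η ^ 2 = p * c₁ / 16 := by
    rw [hη, div_pow, Real.sq_sqrt (by positivity)]; norm_num
  refine ⟨(η * p / 4) ^ (1 / (ℓ : ℝ)) / ℓ, by positivity, ?_⟩
  filter_upwards [hN₀, eventually_ge_atTop 1,
    eventually_le_natCast_rpow (3 / η) (half_pos hε)] with N hN0 hN1 hN3 M S T D A hA
  have hN : (0 : ℝ) < N := by exact_mod_cast hN1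
  have hN0' : 0 < c₁ * (N : ℝ) ^ ε := by positivity
  have hN0pos : 0 < N₀ N := by exact_mod_cast hN0'.trans_le hN0
  by_contra! hT
  set k := ⌈η * (N : ℝ) ^ (ε / 2)⌉₊ with hk
  have hk0 : 0 < η * (N : ℝ) ^ (ε / 2) := by positivity
  have hk1 : 1 ≤ k := Nat.one_le_iff_ne_zero.2 (Nat.ceil_pos.2 hk0).ne'
  have hkge : η * (N : ℝ) ^ (ε / 2) ≤ k := Nat.le_ceil _
  have hkle : (k : ℝ) < η * (N : ℝ) ^ (ε / 2) + 1 := Nat.ceil_lt_add_one hk0.le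
  have h3 : 3 ≤ η * (N : ℝ) ^ (ε / 2) := by
    rw [div_le_iff₀ hη0] at hN3; linarith
  have e1 := rpow_half_sq hN.le ε
  have h1 : ((k : ℝ) + 2) ^ 2 / N₀ N ≤ p / 4 := by
    rw [div_le_iff₀ (by exact_mod_cast hN0pos)]
    calc ((k : ℝ) + 2) ^ 2 ≤ (2 * (η * (N : ℝ) ^ (ε / 2))) ^ 2 :=
          pow_le_pow_left₀ (by positivity) (by linarith) 2
      _ = p / 4 * (c₁ * (N : ℝ) ^ ε) := by rw [mul_pow, mul_pow, e1, hη2]; ring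
      _ ≤ p / 4 * N₀ N := mul_le_mul_of_nonneg_left hN0 (by positivity)
  have h2 : ((ℓ * T : ℕ) : ℝ) ^ ℓ / N / k ≤ p / 4 := by
    have e2 := rpow_queries_pow hℓ ε hN
    have e3 : ((η * p / 4) ^ (1 / (ℓ : ℝ))) ^ ℓ = η * p / 4 :=
      rpow_one_div_pow hℓ (by positivity)
    have h4 : ((ℓ * T : ℕ) : ℝ) ^ ℓ ≤ η * p / 4 * (N * (N : ℝ) ^ (ε / 2)) := by
      rw [← e2, ← e3, ← mul_pow]
      refine pow_le_pow_left₀ (by positivity) ?_ ℓ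
      push_cast
      calc (ℓ : ℝ) * T ≤ ℓ * ((η * p / 4) ^ (1 / (ℓ : ℝ)) / ℓ *
            (N : ℝ) ^ (1 / (ℓ : ℝ) + ε / (2 * (ℓ : ℝ)))) :=
            mul_le_mul_of_nonneg_left hT.le hℓ'.le
        _ = _ := by field_simp
    rw [div_div, div_le_iff₀ (by positivity)]
    refine h4.trans ?_
    calc η * p / 4 * (N * (N : ℝ) ^ (ε / 2)) = p / 4 * (N * (η * (N : ℝ) ^ (ε / 2))) := by ring
      _ ≤ p / 4 * (N * k) := by gcongr
  have h5 := hA.trans (successProb_le A D T fun P y =>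
    P.winProb_le_of_queries T y hℓ hN0pos hk1)
  rw [ENNReal.ofReal_le_ofReal_iff (by positivity)] at h5
  linarith

/-- The block length: of order `(r * N) ^ (1 / ℓ)`, and small enough for the bound on hits. -/
theorem exists_block_length {ℓ : ℕ} (hℓ : 1 ≤ ℓ) :
    ∃ K : ℝ, 0 < K ∧ ∀ᶠ N : ℕ in atTop, ∀ r : ℕ, 1 ≤ r → ∃ τ : ℕ, 1 ≤ τ ∧
      (τ : ℝ) ≤ (r * N : ℝ) ^ (1 / (ℓ : ℝ)) ∧ K * (r * N : ℝ) ^ (1 / (ℓ : ℝ)) ≤ τ ∧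
      6 * ℓ * (ℓ * τ) ^ ℓ ≤ r * N := by
  have hℓ' : (1 : ℝ) ≤ ℓ := by exact_mod_cast hℓ
  have hℓ0 : (0 : ℝ) < ℓ := by linarith
  set K : ℝ := (1 / (6 * ℓ)) ^ (1 / (ℓ : ℝ)) / ℓ with hK
  have hK0 : 0 < K := by positivity
  have hpowK : 6 * ℓ * (ℓ * K) ^ ℓ = 1 := by
    have : ℓ * K = (1 / (6 * ℓ)) ^ (1 / (ℓ : ℝ)) := by rw [hK]; field_simp
    rw [this, rpow_one_div_pow hℓ (by positivity)]
    field_simp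
  have hK1 : K ≤ 1 := by
    rw [hK, div_le_one hℓ0]
    refine (Real.rpow_le_one (by positivity) ?_ (by positivity)).trans hℓ'
    rw [div_le_one (by positivity)]
    linarith
  refine ⟨K / 2, by positivity, ?_⟩
  filter_upwards [tendsto_natCast_atTop_atTop.eventually_ge_atTop (1 / K ^ ℓ)] with N hN r hr
  have hr' : (1 : ℝ) ≤ r := by exact_mod_cast hr
  have hrN : (0 : ℝ) ≤ r * N := by positivity
  have hpow := rpow_one_div_pow hℓ hrN
  set z : ℝ := (r * N : ℝ) ^ (1 / (ℓ : ℝ)) with hz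
  have hz0 : 0 ≤ z := by positivity
  have hx1 : 1 ≤ K * z := by
    by_contra! h
    have h1 : (K * z) ^ ℓ < 1 := pow_lt_one₀ (by positivity) h (by omega)
    rw [mul_pow, hpow] at h1
    rw [div_le_iff₀ (by positivity)] at hN
    have h3 : N * K ^ ℓ ≤ r * (N * K ^ ℓ) := le_mul_of_one_le_left (by positivity) hr'
    linarith
  have hτ1 : 1 ≤ ⌊K * z⌋₊ := Nat.le_floor (by exact_mod_cast hx1)
  have hτx : (⌊K * z⌋₊ : ℝ) ≤ K * z := Nat.floor_le (by linarith)
  refine ⟨⌊K * z⌋₊, hτ1, ?_, ?_, ?_⟩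
  · exact hτx.trans (mul_le_of_le_one_left hz0 hK1)
  · have h1 := Nat.lt_floor_add_one (K * z)
    have h2 : (1 : ℝ) ≤ ⌊K * z⌋₊ := by exact_mod_cast hτ1
    linarith
  · have : (6 * ℓ * (ℓ * ⌊K * z⌋₊) ^ ℓ : ℝ) ≤ r * N := by
      calc (6 * ℓ * (ℓ * ⌊K * z⌋₊) ^ ℓ : ℝ) ≤ 6 * ℓ * (ℓ * (K * z)) ^ ℓ := by gcongr
        _ = 6 * ℓ * (ℓ * K) ^ ℓ * z ^ ℓ := by ring
        _ = r * N := by rw [hpowK, hpow, one_mul]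
    exact_mod_cast this

theorem exists_two_pow_ge {N : ℕ} (hN : 3 ≤ N) :
    ∃ b : ℕ, 1 ≤ b ∧ (N : ℝ) ≤ 2 ^ b ∧ (b : ℝ) ≤ 3 * Real.log N := by
  have hN3 : (3 : ℝ) ≤ N := by exact_mod_cast hN
  have hN : (0 : ℝ) < N := by linarith
  have hlog : 1 ≤ Real.log N := by
    rw [Real.le_log_iff_exp_le hN]
    linarith [Real.exp_one_lt_d9]
  have hlogb : 0 < Real.logb 2 N := Real.logb_pos one_lt_two (by linarith)
  refine ⟨⌈Real.logb 2 N⌉₊, Nat.ceil_pos.2 hlogb, ?_, ?_⟩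
  · rw [← Real.rpow_natCast, ← Real.logb_le_iff_le_rpow one_lt_two hN]
    exact Nat.le_ceil _
  · have h2 := Nat.ceil_lt_add_one hlogb.le
    have h3 : Real.logb 2 N ≤ 2 * Real.log N := by
      rw [Real.logb, div_le_iff₀ (Real.log_pos one_lt_two)]
      nlinarith [Real.log_two_gt_d9]
    linarith

/-- The bound of `DetAlgorithm.winProb_le_of_memory` is less than `p` when fewer than `N ^ 2`
queries violate the tradeoff; `z` stands for `(r * N) ^ (1 / ℓ)`. -/
theorem memory_bound_lt {ℓ N N₀ S T b r τ : ℕ} {ε c₁ K p : ℝ} (hp : 0 < p) (hc₁ : 0 < c₁)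
    (hK : 0 < K) (hN : 1 ≤ N) (hN₀ : c₁ * (N : ℝ) ^ ε ≤ N₀) (hNp : 4 / p ≤ N)
    (hb : (N : ℝ) ≤ 2 ^ b) (hr : r = S + 4 * b) (hr1 : 1 ≤ r) (hT2 : T < N ^ 2) (hτ : 1 ≤ τ)
    (hτT : τ ≤ T) (hKτ : K * (r * N : ℝ) ^ (1 / (ℓ : ℝ)) ≤ τ)
    (hcon : (r : ℝ) ^ ((ℓ : ℝ) - 1 / (ℓ : ℝ)) * T <
      K * √(c₁ * p) / 12 * (N : ℝ) ^ (1 / (ℓ : ℝ) + ε / 2)) :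
    (((T / τ + 1 : ℕ) * 2 ^ S * N : ℝ) / 2 ^ r +
      ((((T / τ + 1) * r ^ ℓ : ℕ) : ℝ) + 2) ^ 2 / N₀) < p := by
  have hN' : (0 : ℝ) < N := by exact_mod_cast hN
  have hN0pos : (0 : ℝ) < N₀ := lt_of_lt_of_le (by positivity) hN₀
  have hr0 : (0 : ℝ) < r := by exact_mod_cast hr1
  have hτ0 : (0 : ℝ) < τ := by exact_mod_cast hτ
  set n := T / τ + 1 with hn
  have hnN : (n : ℝ) ≤ (N : ℝ) ^ 2 := by
    have h2 : T / τ ≤ T := Nat.div_le_self _ _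
    have h3 : n ≤ N ^ 2 := by omega
    exact_mod_cast h3
  have h1 : (n * 2 ^ S * N : ℝ) / 2 ^ r ≤ p / 4 := by
    have e : (2 : ℝ) ^ r = 2 ^ S * (2 ^ b) ^ 4 := by rw [hr, pow_add, pow_mul']
    have h2 : (N : ℝ) ^ 4 ≤ (2 ^ b) ^ 4 := pow_le_pow_left₀ hN'.le hb 4
    rw [div_le_iff₀ (by positivity), e]
    have h3 : 1 ≤ p / 4 * N := by
      rw [div_le_iff₀ hp] at hNp; linarith
    calc (n * 2 ^ S * N : ℝ) ≤ (N : ℝ) ^ 2 * 2 ^ S * N := by gcongr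
      _ = 1 * (2 ^ S * N ^ 3) := by ring
      _ ≤ p / 4 * N * (2 ^ S * N ^ 3) := by gcongr
      _ = p / 4 * (2 ^ S * N ^ 4) := by ring
      _ ≤ _ := by gcongr
  set w : ℝ := √(c₁ * p) with hw
  have hw2 : w ^ 2 = c₁ * p := Real.sq_sqrt (by positivity)
  have h2 : ((n * r ^ ℓ : ℕ) : ℝ) + 2 ≤ w / 2 * (N : ℝ) ^ (ε / 2) := by
    have hn1 : (n : ℝ) ≤ 2 * T / (K * (r * N : ℝ) ^ (1 / (ℓ : ℝ))) := by
      have h1 : ((T / τ : ℕ) : ℝ) ≤ T / τ := Nat.cast_div_le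
      have h2 : (1 : ℝ) ≤ T / τ := by
        rw [one_le_div hτ0]; exact_mod_cast hτT
      calc (n : ℝ) ≤ 2 * T / τ := by rw [hn, mul_div_assoc]; push_cast; linarith
        _ ≤ _ := by gcongr
    have h4 : ((n * r ^ ℓ : ℕ) : ℝ) + 2 ≤ 3 * (n * r ^ ℓ) := by
      have h3 : 1 ≤ n * r ^ ℓ := Nat.mul_pos (Nat.succ_pos _) (Nat.pow_pos hr1)
      have : (1 : ℝ) ≤ n * r ^ ℓ := by exact_mod_cast h3
      push_cast
      linarith
    have e1 : (r : ℝ) ^ ℓ = (r : ℝ) ^ ((ℓ : ℝ) - 1 / (ℓ : ℝ)) * (r : ℝ) ^ (1 / (ℓ : ℝ)) := by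
      rw [← Real.rpow_add hr0, ← Real.rpow_natCast]; congr 1; ring
    have e2 : (r * N : ℝ) ^ (1 / (ℓ : ℝ)) = (r : ℝ) ^ (1 / (ℓ : ℝ)) * (N : ℝ) ^ (1 / (ℓ : ℝ)) :=
      Real.mul_rpow hr0.le hN'.le
    have hrp : (0 : ℝ) < (r : ℝ) ^ (1 / (ℓ : ℝ)) := by positivity
    have hNp' : (0 : ℝ) < (N : ℝ) ^ (1 / (ℓ : ℝ)) := by positivity
    calc ((n * r ^ ℓ : ℕ) : ℝ) + 2 ≤ 3 * (n * r ^ ℓ) := h4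
      _ ≤ 3 * (2 * T / (K * (r * N : ℝ) ^ (1 / (ℓ : ℝ))) * r ^ ℓ) := by gcongr
      _ = 6 / K * ((r : ℝ) ^ ((ℓ : ℝ) - 1 / (ℓ : ℝ)) * T) / (N : ℝ) ^ (1 / (ℓ : ℝ)) := by
          rw [e2, e1]; field_simp; ring
      _ ≤ 6 / K * (K * w / 12 * (N : ℝ) ^ (1 / (ℓ : ℝ) + ε / 2)) / (N : ℝ) ^ (1 / (ℓ : ℝ)) := by
          gcongr
      _ = _ := by rw [Real.rpow_add hN']; field_simp; ring
  have h3 : (((n * r ^ ℓ : ℕ) : ℝ) + 2) ^ 2 / N₀ ≤ p / 4 := by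
    rw [div_le_iff₀ hN0pos]
    calc (((n * r ^ ℓ : ℕ) : ℝ) + 2) ^ 2 ≤ (w / 2 * (N : ℝ) ^ (ε / 2)) ^ 2 :=
          pow_le_pow_left₀ (by positivity) h2 2
      _ = p / 4 * (c₁ * (N : ℝ) ^ ε) := by
          rw [mul_pow, div_pow, rpow_half_sq hN'.le, hw2]; ring
      _ ≤ p / 4 * N₀ := mul_le_mul_of_nonneg_left hN₀ (by positivity)
  linarith

/-- With `S` bits of memory, put `R = S + 12 log N`. Either `R` is at least of order `N ^ (ε / 2)`,
or the number of queries satisfies a tradeoff with `R`. The first case arises from fewer queries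
than one block, which `queries_lower_bound` allows only for such large `R`. -/
theorem memory_lower_bound {ℓ : ℕ} {ε c₁ : ℝ} {N₀ : ℕ → ℕ} (hℓ : 2 ≤ ℓ) (hε : 0 < ε) (hε2 : ε ≤ 2)
    (hc₁ : 0 < c₁) (hN₀ : ∀ᶠ N : ℕ in atTop, c₁ * (N : ℝ) ^ ε ≤ N₀ N) {p : ℝ} (hp : 0 < p) :
    ∃ c : ℝ, 0 < c ∧ ∀ᶠ N : ℕ in atTop,
      ∀ (M S T : ℕ) (D : PMF (Fin N)) (A : RandAlgorithm ℓ M N (N₀ N) S),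
        ENNReal.ofReal p ≤ successProb A D T →
        c * (N : ℝ) ^ (ε / 2) ≤ S + 12 * Real.log N ∨
        c * (N : ℝ) ^ (1 / (ℓ : ℝ) + ε / 2) ≤
          (S + 12 * Real.log N) ^ ((ℓ : ℝ) - 1 / (ℓ : ℝ)) * T := by
  have hℓ1 : 1 ≤ ℓ := by omega
  have hℓ2 : (2 : ℝ) ≤ ℓ := by exact_mod_cast hℓ
  have hinv : 1 / (ℓ : ℝ) ≤ 1 / 2 := one_div_le_one_div_of_le two_pos hℓ2
  have hexp : 0 ≤ (ℓ : ℝ) - 1 / (ℓ : ℝ) := by linarith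
  obtain ⟨c', hc', hB⟩ := queries_lower_bound hℓ1 hε hc₁ hN₀ hp
  obtain ⟨K, hK, hblock⟩ := exists_block_length hℓ1
  set c₂ : ℝ := K * √(c₁ * p) / 12 with hc₂
  have hc₂0 : 0 < c₂ := by positivity
  refine ⟨min (c' ^ ℓ) (min 1 c₂), by positivity, ?_⟩
  filter_upwards [hN₀, hB, hblock, eventually_ge_atTop 3,
    tendsto_natCast_atTop_atTop.eventually_ge_atTop (4 / p)]
    with N hN0 hNB hNblock hN1 hNp M S T D A hA
  have hTB := hNB M S T D A hA
  have hN3 : (3 : ℝ) ≤ N := by exact_mod_cast hN1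
  have hN : (0 : ℝ) < N := by linarith
  have hN0pos : 0 < N₀ N := by
    have : 0 < c₁ * (N : ℝ) ^ ε := by positivity
    exact_mod_cast this.trans_le hN0
  -- the threshold `r` for the number of hits is chosen so that `2 ^ r ≥ 2 ^ S * N ^ 4`
  obtain ⟨b, hb0, hb1, hb2⟩ := exists_two_pow_ge hN1
  obtain ⟨r, hr⟩ : ∃ r, r = S + 4 * b := ⟨_, rfl⟩
  have hr1 : 1 ≤ r := by omega
  have hr1' : (1 : ℝ) ≤ r := by exact_mod_cast hr1
  set R : ℝ := S + 12 * Real.log N with hR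
  have hrR : (r : ℝ) ≤ R := by
    rw [hr, hR]; push_cast; linarith
  have hR1 : 1 ≤ R := hr1'.trans hrR
  rcases le_or_gt (N ^ 2) T with hT2 | hT2
  · right
    calc min (c' ^ ℓ) (min 1 c₂) * (N : ℝ) ^ (1 / (ℓ : ℝ) + ε / 2)
        ≤ 1 * (N : ℝ) ^ ((2 : ℕ) : ℝ) := by
          refine mul_le_mul ((min_le_right _ _).trans (min_le_left _ _)) ?_ (by positivity)
            zero_le_one
          refine Real.rpow_le_rpow_of_exponent_le (by linarith) ?_
          push_cast
          linarith
      _ ≤ R ^ ((ℓ : ℝ) - 1 / (ℓ : ℝ)) * T := by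
          rw [Real.rpow_natCast]
          exact mul_le_mul (Real.one_le_rpow hR1 hexp) (by exact_mod_cast hT2) (by positivity)
            (by positivity)
  obtain ⟨τ, hτ1, hτle, hτge, hτ⟩ := hNblock r hr1
  rcases lt_or_ge T τ with hTτ | hTτ
  · left
    have h1 : c' * (N : ℝ) ^ (1 / (ℓ : ℝ) + ε / (2 * (ℓ : ℝ))) ≤ (r * N : ℝ) ^ (1 / (ℓ : ℝ)) := by
      have h2 : (T : ℝ) ≤ τ := by exact_mod_cast hTτ.le
      exact (hTB.trans h2).trans hτle
    have h2 := pow_le_pow_left₀ (by positivity) h1 ℓ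
    rw [rpow_one_div_pow hℓ1 (by positivity), mul_pow, rpow_queries_pow hℓ1 ε hN,
      mul_left_comm, mul_comm (r : ℝ)] at h2
    have h3 := le_of_mul_le_mul_left h2 hN
    calc _ ≤ c' ^ ℓ * (N : ℝ) ^ (ε / 2) := by gcongr; exact min_le_left _ _
      _ ≤ R := h3.trans hrR
  · right
    by_contra! hcon
    have hcon' : (r : ℝ) ^ ((ℓ : ℝ) - 1 / (ℓ : ℝ)) * T < c₂ * (N : ℝ) ^ (1 / (ℓ : ℝ) + ε / 2) := by
      calc _ ≤ R ^ ((ℓ : ℝ) - 1 / (ℓ : ℝ)) * T := by gcongr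
        _ < _ := hcon
        _ ≤ _ := by gcongr; exact (min_le_right _ _).trans (min_le_right _ _)
    have hTn : T ≤ (T / τ + 1) * τ := by
      have := Nat.lt_div_mul_add (a := T) hτ1
      rw [add_mul, one_mul]
      exact this.le
    have h5 := hA.trans (successProb_le A D T fun P y =>
      P.winProb_le_of_memory T y hℓ1 hN0pos hτ1 hTn hτ)
    rw [ENNReal.ofReal_le_ofReal_iff (by positivity)] at h5
    exact absurd h5 (not_le.2 (memory_bound_lt hp hc₁ hK (by omega) hN0 hNp hb1 hr hr1 hT2 hτ1 hTτ
      hτge hcon'))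

/-- The tradeoff for space between `log N` and `N ^ (1 / (ℓ ^ 2 - 1))`. If `S` is at least of order
`N ^ (ε / 2)`, the bound for unbounded space suffices; otherwise half of the power of `S` in the
tradeoff of `memory_lower_bound` is estimated by the upper bound on `S`. -/
theorem tradeoff_lower_bound {ℓ : ℕ} {ε c₁ : ℝ} {N₀ : ℕ → ℕ} (hℓ : 2 ≤ ℓ) (hε : 0 < ε) (hε2 : ε ≤ 2)
    (hc₁ : 0 < c₁) (hN₀ : ∀ᶠ N : ℕ in atTop, c₁ * (N : ℝ) ^ ε ≤ N₀ N) {p a b : ℝ} (hp : 0 < p)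
    (ha : 0 < a) (hb : 0 < b) :
    ∃ c : ℝ, 0 < c ∧ ∀ᶠ N : ℕ in atTop,
      ∀ (M S T : ℕ) (D : PMF (Fin N)) (A : RandAlgorithm ℓ M N (N₀ N) S),
        a * Real.log N ≤ S → (S : ℝ) ≤ b * (N : ℝ) ^ (1 / ((ℓ : ℝ) ^ 2 - 1)) →
        ENNReal.ofReal p ≤ successProb A D T →
        c * (N : ℝ) ^ (1 / (2 * (ℓ : ℝ)) + ε / 2) ≤
          (S : ℝ) ^ (((ℓ : ℝ) ^ 2 - 1) / (2 * (ℓ : ℝ))) * T := by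
  have hℓ2 : (2 : ℝ) ≤ ℓ := by exact_mod_cast hℓ
  have hℓ' : (0 : ℝ) < ℓ := by linarith
  have hsq : (0 : ℝ) < (ℓ : ℝ) ^ 2 - 1 := by nlinarith
  obtain ⟨c', hc', hB⟩ := queries_lower_bound (by omega : 1 ≤ ℓ) hε hc₁ hN₀ hp
  obtain ⟨c, hc, hA⟩ := memory_lower_bound hℓ hε hε2 hc₁ hN₀ hp
  set e : ℝ := ((ℓ : ℝ) ^ 2 - 1) / (2 * (ℓ : ℝ)) with he
  have he0 : 0 < e := by positivity
  have he2 : (ℓ : ℝ) - 1 / (ℓ : ℝ) = e + e := by rw [he]; field_simp; ring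
  set C : ℝ := 1 + 12 / a with hC
  have hC0 : 0 < C := by positivity
  refine ⟨min ((c / C) ^ e * c') (c / (C ^ (e + e) * b ^ e)), by positivity, ?_⟩
  filter_upwards [hB, hA, eventually_ge_atTop 2] with N hNB hNA hN2 M S T D A haS hbS hsucc
  have hN1 : (1 : ℝ) < N := by exact_mod_cast hN2
  have hN : (0 : ℝ) < N := by linarith
  have hlog := Real.log_pos hN1
  have hS : (0 : ℝ) < S := lt_of_lt_of_le (by positivity) haS
  have hR : (S : ℝ) + 12 * Real.log N ≤ C * S := by
    have : 12 * Real.log N ≤ 12 / a * S := by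
      rw [div_mul_eq_mul_div, le_div_iff₀ ha]; linarith
    rw [hC]; linarith
  have hT := hNB M S T D A hsucc
  rcases hNA M S T D A hsucc with h | h
  · have h1 : c / C * (N : ℝ) ^ (ε / 2) ≤ S := by
      rw [div_mul_eq_mul_div, div_le_iff₀ hC0]
      linarith
    calc _ ≤ (c / C) ^ e * c' * (N : ℝ) ^ (1 / (2 * (ℓ : ℝ)) + ε / 2) := by
          gcongr; exact min_le_left _ _
      _ ≤ (c / C) ^ e * c' * (N : ℝ) ^ (ε / 2 * e + (1 / (ℓ : ℝ) + ε / (2 * (ℓ : ℝ)))) := by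
          refine mul_le_mul_of_nonneg_left (Real.rpow_le_rpow_of_exponent_le hN1.le ?_)
            (by positivity)
          · -- the difference of the two exponents is `1 / (2 ℓ) + ε (ℓ - 1)² / (4 ℓ)`
            have : ε / 2 * e + (1 / (ℓ : ℝ) + ε / (2 * (ℓ : ℝ))) -
                (1 / (2 * (ℓ : ℝ)) + ε / 2) =
                1 / (2 * (ℓ : ℝ)) + ε * ((ℓ : ℝ) - 1) ^ 2 / (4 * ℓ) := by
              rw [he]; field_simp; ring
            have h2 : 0 ≤ 1 / (2 * (ℓ : ℝ)) + ε * ((ℓ : ℝ) - 1) ^ 2 / (4 * ℓ) := by positivity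
            linarith
      _ = (c / C * (N : ℝ) ^ (ε / 2)) ^ e *
            (c' * (N : ℝ) ^ (1 / (ℓ : ℝ) + ε / (2 * (ℓ : ℝ)))) := by
          rw [Real.rpow_add hN, Real.mul_rpow (by positivity) (by positivity),
            ← Real.rpow_mul hN.le]
          ring
      _ ≤ _ := by gcongr
  · have h1 : (S : ℝ) ^ e ≤ b ^ e * (N : ℝ) ^ (1 / (2 * (ℓ : ℝ))) := by
      calc (S : ℝ) ^ e ≤ (b * (N : ℝ) ^ (1 / ((ℓ : ℝ) ^ 2 - 1))) ^ e := by gcongr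
        _ = _ := by
          rw [Real.mul_rpow hb.le (by positivity), ← Real.rpow_mul hN.le]
          congr 2
          rw [he]; field_simp
    have h2 : c * (N : ℝ) ^ (1 / (ℓ : ℝ) + ε / 2) ≤
        C ^ (e + e) * (b ^ e * (N : ℝ) ^ (1 / (2 * (ℓ : ℝ)))) * ((S : ℝ) ^ e * T) := by
      calc _ ≤ (S + 12 * Real.log N : ℝ) ^ ((ℓ : ℝ) - 1 / (ℓ : ℝ)) * T := h
        _ ≤ (C * S) ^ (e + e) * T := by rw [he2]; gcongr
        _ = C ^ (e + e) * (S : ℝ) ^ e * ((S : ℝ) ^ e * T) := by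
            rw [Real.mul_rpow hC0.le hS.le, Real.rpow_add hS]; ring
        _ ≤ _ := by gcongr
    have e3 : (N : ℝ) ^ (1 / (ℓ : ℝ) + ε / 2) =
        (N : ℝ) ^ (1 / (2 * (ℓ : ℝ)) + ε / 2) * (N : ℝ) ^ (1 / (2 * (ℓ : ℝ))) := by
      rw [← Real.rpow_add hN]; congr 1; field_simp; ring
    have hNpos : (0 : ℝ) < (N : ℝ) ^ (1 / (2 * (ℓ : ℝ))) := by positivity
    have h3 : c * (N : ℝ) ^ (1 / (2 * (ℓ : ℝ)) + ε / 2) ≤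
        C ^ (e + e) * b ^ e * ((S : ℝ) ^ e * T) := by
      refine le_of_mul_le_mul_right ?_ hNpos
      calc _ = c * (N : ℝ) ^ (1 / (ℓ : ℝ) + ε / 2) := by rw [e3]; ring
        _ ≤ _ := h2
        _ = _ := by ring
    calc _ ≤ c / (C ^ (e + e) * b ^ e) * (N : ℝ) ^ (1 / (2 * (ℓ : ℝ)) + ε / 2) := by
          gcongr; exact min_le_right _ _
      _ ≤ _ := by
          rw [div_mul_eq_mul_div, div_le_iff₀ (by positivity)]
          linarith

/-- Space `N ^ δ` costs at most a factor `N ^ (ℓ * δ)` against `N ^ (1 / ℓ + ε / 2)`. -/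
theorem small_space_lower_bound {ℓ : ℕ} {ε c₁ : ℝ} {N₀ : ℕ → ℕ} (hℓ : 2 ≤ ℓ) (hε : 0 < ε)
    (hε2 : ε ≤ 2) (hc₁ : 0 < c₁) (hN₀ : ∀ᶠ N : ℕ in atTop, c₁ * (N : ℝ) ^ ε ≤ N₀ N) {p δ : ℝ}
    (hp : 0 < p) (hδ : 0 < δ) (hδε : δ < ε / 2) :
    ∀ᶠ N : ℕ in atTop,
      ∀ (M S T : ℕ) (D : PMF (Fin N)) (A : RandAlgorithm ℓ M N (N₀ N) S),
        (S : ℝ) ≤ (N : ℝ) ^ δ → ENNReal.ofReal p ≤ successProb A D T →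
        (N : ℝ) ^ (1 / (ℓ : ℝ) + ε / 2 - ℓ * δ) ≤ T := by
  have hℓ2 : (2 : ℝ) ≤ ℓ := by exact_mod_cast hℓ
  have hℓ' : (0 : ℝ) < ℓ := by linarith
  obtain ⟨c, hc, hA⟩ := memory_lower_bound hℓ hε hε2 hc₁ hN₀ hp
  set e : ℝ := (ℓ : ℝ) - 1 / (ℓ : ℝ) with he
  have he0 : 0 < e := by
    have : 1 / (ℓ : ℝ) ≤ 1 / 2 := one_div_le_one_div_of_le two_pos hℓ2
    rw [he]; linarith
  filter_upwards [hA, eventually_ge_atTop 2, eventually_mul_log_le_rpow 12 hδ,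
    eventually_le_natCast_rpow (3 / c) (sub_pos.2 hδε),
    eventually_le_natCast_rpow (2 ^ e / c) (div_pos hδ hℓ')]
    with N hNA hN2 hlog hcase hfac M S T D A hS hsucc
  have hN1 : (1 : ℝ) < N := by exact_mod_cast hN2
  have hN : (0 : ℝ) < N := by linarith
  have hlog0 := Real.log_pos hN1
  have hR : (S : ℝ) + 12 * Real.log N ≤ 2 * (N : ℝ) ^ δ := by linarith
  have hNδ : (0 : ℝ) < (N : ℝ) ^ δ := by positivity
  rcases hNA M S T D A hsucc with h | h
  · exfalso
    rw [div_le_iff₀ hc] at hcase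
    have e1 : (N : ℝ) ^ (ε / 2) = (N : ℝ) ^ (ε / 2 - δ) * (N : ℝ) ^ δ := by
      rw [← Real.rpow_add hN]; congr 1; ring
    rw [e1] at h
    nlinarith
  · have hS0 : (0 : ℝ) ≤ S := by positivity
    have h1 : c * (N : ℝ) ^ (1 / (ℓ : ℝ) + ε / 2) ≤ 2 ^ e * (N : ℝ) ^ (δ * e) * T := by
      calc _ ≤ (S + 12 * Real.log N : ℝ) ^ e * T := h
        _ ≤ (2 * (N : ℝ) ^ δ) ^ e * T := by gcongr
        _ = _ := by rw [Real.mul_rpow two_pos.le hNδ.le, ← Real.rpow_mul hN.le]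
    have h2 : (2 : ℝ) ^ e ≤ c * (N : ℝ) ^ (δ / ℓ) := by
      rw [div_le_iff₀ hc] at hfac; linarith
    have e2 : (N : ℝ) ^ (1 / (ℓ : ℝ) + ε / 2) = (N : ℝ) ^ (δ / ℓ) *
        ((N : ℝ) ^ (δ * e) * (N : ℝ) ^ (1 / (ℓ : ℝ) + ε / 2 - ℓ * δ)) := by
      rw [← Real.rpow_add hN, ← Real.rpow_add hN]; congr 1; rw [he]; field_simp; ring
    have hpos : (0 : ℝ) < 2 ^ e * (N : ℝ) ^ (δ * e) := by positivity
    refine le_of_mul_le_mul_left ?_ hpos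
    calc _ = 2 ^ e * ((N : ℝ) ^ (δ * e) * (N : ℝ) ^ (1 / (ℓ : ℝ) + ε / 2 - ℓ * δ)) := by ring
      _ ≤ c * (N : ℝ) ^ (δ / ℓ) *
          ((N : ℝ) ^ (δ * e) * (N : ℝ) ^ (1 / (ℓ : ℝ) + ε / 2 - ℓ * δ)) := by gcongr
      _ = c * (N : ℝ) ^ (1 / (ℓ : ℝ) + ε / 2) := by rw [e2]; ring
      _ ≤ _ := h1

end LowerBounds

/-! ### An algorithm with unbounded space -/

section TableAlgorithm

variable {ℓ M N N₀ : ℕ}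

/-- There is an algorithm that queries `H` at the first `Q` points and `G` at the first `k` tuples of
a list `cand` that it computes from the values of `H` seen so far. It remembers all answers, so it
wins whenever two of these tuples form a collision. The memory holds complete tables for `H` and
`G`, with arbitrary entries at the points not yet queried. -/
theorem exists_tableAlgorithm (Q k : ℕ) (hQ : Q ≤ M) (hM : 0 < M) (hN : 0 < N) (hN₀ : 0 < N₀)
    (cand : Fin N → (Fin M → Fin N) → List (Tuple ℓ M))
    (hcand : ∀ y (h h' : Fin M → Fin N), (∀ x : Fin M, (x : ℕ) < Q → h x = h' x) →
      cand y h = cand y h')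
    (hvalid : ∀ y h, ∀ x ∈ cand y h, x ∈ validTuples h y) :
    ∃ (S : ℕ) (P : DetAlgorithm ℓ M N N₀ S), ∀ H G y,
      (∃ x ∈ (cand y H).take k, ∃ x' ∈ (cand y H).take k, x ≠ x' ∧ G x = G x') →
        P.Wins (Q + k) H G y := by
  classical
  let Table := (Fin M → Fin N) × (Tuple ℓ M → Fin N₀)
  obtain ⟨enc⟩ : Nonempty (Table ↪ Memory (Fintype.card Table)) := by
    refine Function.Embedding.nonempty_of_card_le ?_
    simp only [Fintype.card_fun, Fintype.card_bool, Fintype.card_fin]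
    exact Nat.lt_two_pow_self.le
  let z₀ : Tuple ℓ M := fun _ => ⟨0, hM⟩
  let s₀ : Table := (fun _ => ⟨0, hN⟩, fun _ => ⟨0, hN₀⟩)
  let dec : Memory (Fintype.card Table) → Table := fun m =>
    if hm : ∃ s, enc s = m then hm.choose else s₀
  have hdec : ∀ s, dec (enc s) = s := fun s => by
    have hm : ∃ s', enc s' = enc s := ⟨s, rfl⟩
    simp only [dec, dif_pos hm]
    exact enc.injective hm.choose_spec
  let ask : Fin N → ℕ → Table → Fin M ⊕ Tuple ℓ M := fun y t s =>
    if ht : t < Q then Sum.inl ⟨t, ht.trans_le hQ⟩ else Sum.inr ((cand y s.1).getD (t - Q) z₀)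
  let write : Table → Fin M ⊕ Tuple ℓ M → Fin N ⊕ Fin N₀ → Table := fun s q a =>
    match q, a with
    | Sum.inl x, Sum.inl v => (Function.update s.1 x v, s.2)
    | Sum.inr z, Sum.inr v => (s.1, Function.update s.2 z v)
    | _, _ => s
  let good : Fin N → Table → Tuple ℓ M × Tuple ℓ M → Prop := fun y s p =>
    p.1 ∈ (cand y s.1).take k ∧ p.2 ∈ (cand y s.1).take k ∧ p.1 ≠ p.2 ∧ s.2 p.1 = s.2 p.2
  let P : DetAlgorithm ℓ M N N₀ (Fintype.card Table) :=
    { init := fun _ => enc s₀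
      query := fun y t m => ask y t (dec m)
      update := fun y t m a => enc (write (dec m) (ask y t (dec m)) a)
      output := fun y m => if hp : ∃ p, good y (dec m) p then hp.choose else (z₀, z₀) }
  refine ⟨_, P, fun H G y hcol => ?_⟩
  let st : ℕ → Table := fun t => dec (P.memoryAfter H G y t)
  have hst : ∀ t, st (t + 1) = write (st t) (ask y t (st t)) (Sum.map H G (ask y t (st t))) :=
    fun t => hdec _
  have hH : ∀ t ≤ Q, ∀ x : Fin M, (x : ℕ) < t → (st t).1 x = H x := by
    intro t
    induction t with
    | zero => intro _ x hx; omega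
    | succ t ih =>
      intro ht x hx
      have hask : ask y t (st t) = Sum.inl ⟨t, (Nat.lt_of_succ_le ht).trans_le hQ⟩ :=
        dif_pos (Nat.lt_of_succ_le ht)
      rw [hst, hask]
      simp only [Sum.map_inl, write]
      by_cases hxt : x = ⟨t, (Nat.lt_of_succ_le ht).trans_le hQ⟩
      · rw [hxt, Function.update_self]
      · rw [Function.update_of_ne hxt]
        refine ih (by omega) x ?_
        have : (x : ℕ) ≠ t := fun h => hxt (Fin.ext h)
        omega
  have hG : ∀ i, (∀ x : Fin M, (x : ℕ) < Q → (st (Q + i)).1 x = H x) ∧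
      ∀ z ∈ (cand y H).take i, (st (Q + i)).2 z = G z := by
    intro i
    induction i with
    | zero => exact ⟨hH Q le_rfl, by simp⟩
    | succ i ih =>
      obtain ⟨ih1, ih2⟩ := ih
      have hc : cand y (st (Q + i)).1 = cand y H := hcand _ _ _ ih1
      have hask : ask y (Q + i) (st (Q + i)) = Sum.inr ((cand y H).getD i z₀) := by
        simp only [ask]
        rw [dif_neg (by omega), hc, Nat.add_sub_cancel_left]
      rw [← Nat.add_assoc, hst, hask]
      simp only [Sum.map_inr, write]
      refine ⟨ih1, fun z hz => ?_⟩
      by_cases hzi : z = (cand y H).getD i z₀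
      · rw [hzi, Function.update_self]
      · rw [Function.update_of_ne hzi]
        refine ih2 z ?_
        rw [List.take_add_one, List.mem_append] at hz
        refine hz.resolve_right fun hz' => hzi ?_
        rw [Option.mem_toList] at hz'
        rw [List.getD_eq_getElem?_getD, hz', Option.getD_some]
  obtain ⟨hH', hG'⟩ := hG k
  have hc : cand y (st (Q + k)).1 = cand y H := hcand _ _ _ hH'
  obtain ⟨x, hx, x', hx', hne, hxx⟩ := hcol
  have hex : ∃ p, good y (st (Q + k)) p := by
    refine ⟨(x, x'), ?_, ?_, hne, ?_⟩
    · rwa [hc]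
    · rwa [hc]
    · rw [hG' x hx, hG' x' hx', hxx]
  have hout : P.output y (P.memoryAfter H G y (Q + k)) = hex.choose := dif_pos hex
  obtain ⟨h1, h2, h3, h4⟩ := hex.choose_spec
  rw [hc] at h1 h2
  rw [hG' _ h1, hG' _ h2] at h4
  have v1 := mem_validTuples.1 (hvalid y H _ (List.mem_of_mem_take h1))
  have v2 := mem_validTuples.1 (hvalid y H _ (List.mem_of_mem_take h2))
  rw [DetAlgorithm.Wins, hout]
  exact ⟨h3, v1.1, v2.1, v1.2, v2.2, h4⟩

end TableAlgorithm

/-! ### The second moment method -/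

section SecondMoment

/-- Chebyshev's inequality for the number of pairwise independent events of equal probability `p`
that occur. -/
theorem card_few_events_le {Ω ι : Type*} [Fintype Ω] [DecidableEq ι] (I : Finset ι)
    (E : ι → Ω → Prop) [∀ i, DecidablePred (E i)] {p : ℝ}
    (h1 : ∀ i ∈ I, ((Finset.univ.filter (E i)).card : ℝ) = p * Fintype.card Ω)
    (h2 : ∀ i ∈ I, ∀ j ∈ I, i ≠ j →
      ((Finset.univ.filter fun ω => E i ω ∧ E j ω).card : ℝ) ≤ p ^ 2 * Fintype.card Ω)
    {k : ℕ} (hk : (2 * k : ℝ) ≤ I.card * p) (hpos : 0 < I.card * p) :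
    ((Finset.univ.filter fun ω => (I.filter fun i => E i ω).card < k).card : ℝ) ≤
      4 / (I.card * p) * Fintype.card Ω := by
  classical
  set μ : ℝ := I.card * p with hμ
  let e : ι → Ω → ℝ := fun i ω => if E i ω then 1 else 0
  let X : Ω → ℝ := fun ω => ∑ i ∈ I, e i ω
  have hX : ∀ ω, X ω = ((I.filter fun i => E i ω).card : ℝ) := fun ω => by
    simp only [X, e, Finset.card_filter]
    push_cast
    rfl
  have hsum1 : ∑ ω, X ω = μ * Fintype.card Ω := by
    simp only [X]
    rw [Finset.sum_comm]
    have : ∀ i ∈ I, ∑ ω, e i ω = p * Fintype.card Ω := fun i hi => by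
      rw [← h1 i hi, Finset.card_filter]
      push_cast
      rfl
    rw [Finset.sum_congr rfl this, Finset.sum_const, nsmul_eq_mul, hμ]
    ring
  have hsum2 : ∑ ω, X ω ^ 2 ≤ (μ + μ ^ 2) * Fintype.card Ω := by
    have h3 : ∀ i ∈ I, ∀ j ∈ I, ∑ ω, e i ω * e j ω ≤
        ((if i = j then p else 0) + p ^ 2) * Fintype.card Ω := by
      intro i hi j hj
      have h4 : ∑ ω, e i ω * e j ω =
          ((Finset.univ.filter fun ω => E i ω ∧ E j ω).card : ℝ) := by
        rw [Finset.card_filter]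
        push_cast
        refine Finset.sum_congr rfl fun ω _ => ?_
        simp only [e]
        by_cases hi' : E i ω <;> by_cases hj' : E j ω <;> simp [hi', hj']
      rw [h4]
      by_cases hij : i = j
      · subst hij
        simp only [and_self, if_true]
        rw [h1 i hi, add_mul]
        have : 0 ≤ p ^ 2 * (Fintype.card Ω : ℝ) := by positivity
        linarith
      · rw [if_neg hij, zero_add]
        exact h2 i hi j hj hij
    calc ∑ ω, X ω ^ 2 = ∑ i ∈ I, ∑ j ∈ I, ∑ ω, e i ω * e j ω := by
          simp only [X, sq, Finset.sum_mul_sum]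
          rw [Finset.sum_comm]
          exact Finset.sum_congr rfl fun i _ => Finset.sum_comm
      _ ≤ ∑ i ∈ I, ∑ j ∈ I, ((if i = j then p else 0) + p ^ 2) * Fintype.card Ω :=
          Finset.sum_le_sum fun i hi => Finset.sum_le_sum fun j hj => h3 i hi j hj
      _ = ∑ i ∈ I, (p + I.card * p ^ 2) * Fintype.card Ω := by
          refine Finset.sum_congr rfl fun i hi => ?_
          rw [← Finset.sum_mul, Finset.sum_add_distrib, Finset.sum_ite_eq, if_pos hi,
            Finset.sum_const, nsmul_eq_mul]
      _ = _ := by rw [Finset.sum_const, nsmul_eq_mul, hμ]; ring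
  have hvar : ∑ ω, (X ω - μ) ^ 2 ≤ μ * Fintype.card Ω := by
    have h3 : ∑ ω, (X ω - μ) ^ 2 =
        ∑ ω, X ω ^ 2 - 2 * μ * ∑ ω, X ω + μ ^ 2 * Fintype.card Ω := by
      rw [Finset.mul_sum, ← Finset.sum_sub_distrib, mul_comm (μ ^ 2), ← nsmul_eq_mul,
        ← Finset.card_univ, ← Finset.sum_const, ← Finset.sum_add_distrib]
      exact Finset.sum_congr rfl fun ω _ => by ring
    rw [h3, hsum1]
    linarith
  set W := Finset.univ.filter fun ω => (I.filter fun i => E i ω).card < k with hW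
  have hcheb : (W.card : ℝ) * (μ / 2) ^ 2 ≤ μ * Fintype.card Ω := by
    refine le_trans ?_ hvar
    rw [← nsmul_eq_mul, ← Finset.sum_const]
    refine (Finset.sum_le_sum fun ω hω => ?_).trans
      (Finset.sum_le_sum_of_subset_of_nonneg (Finset.filter_subset _ _) fun _ _ _ => sq_nonneg _)
    have h3 : X ω ≤ k := by
      rw [hX]
      exact_mod_cast (Finset.mem_filter.1 hω).2.le
    nlinarith
  rw [div_mul_eq_mul_div, le_div_iff₀ hpos]
  have h5 : μ * (W.card * μ) ≤ μ * (4 * Fintype.card Ω) := by nlinarith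
  exact le_of_mul_le_mul_left h5 hpos

variable {X Y : Type*} [Fintype X] [DecidableEq X] [Fintype Y]

open Classical in
/-- If, whatever the other values, exactly one value at `x` makes `A` true, and `B` does not depend
on the value at `x`, then `A` has conditional probability `1 / |Y|` given `B`. -/
theorem card_filter_and_of_existsUnique [Nonempty Y] (A B : (X → Y) → Prop) (x : X)
    (hA : ∀ H, ∃! v, A (Function.update H x v))
    (hB : ∀ H v, B (Function.update H x v) ↔ B H) :
    ((Finset.univ.filter fun H => A H ∧ B H).card : ℝ) =
      1 / Fintype.card Y * (Finset.univ.filter B).card := by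
  have hY : (Fintype.card Y : ℝ) ≠ 0 := by exact_mod_cast Fintype.card_ne_zero
  have key := sum_sum_update_eq (X := X) (Y := Y) B (fun _ => x)
    (fun H v h => ⟨(hB H v).2 h, rfl⟩) (fun H => if A H then 1 else 0)
  have h1 : ∀ H, ∑ v : Y, (if A (Function.update H x v) then (1 : ℝ) else 0) = 1 := fun H => by
    obtain ⟨v, hv, huniq⟩ := hA H
    rw [Finset.sum_eq_single v (fun w _ hw => if_neg fun h => hw (huniq w h))
      (fun h => absurd (Finset.mem_univ v) h), if_pos hv]
  simp only [h1, Finset.sum_const, nsmul_eq_mul, mul_one] at key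
  rw [key, Finset.sum_ite, Finset.sum_const_zero, add_zero, Finset.sum_const, nsmul_eq_mul,
    mul_one, Finset.filter_filter]
  simp only [and_comm (a := B _)]
  field_simp

open Classical in
/-- A random function on a set of `2 * k` points is injective with probability at most
`4 * |Y| / k ^ 2`. The events that a point of one half collides with a point of the other half are
pairwise independent. -/
theorem card_injOn_le [Nonempty Y] (F : Finset X) (k : ℕ) (hF : 2 * k ≤ F.card)
    (hk : (2 : ℝ) * Fintype.card Y ≤ (k : ℝ) ^ 2) :
    ((Finset.univ.filter fun G : X → Y => Set.InjOn G F).card : ℝ) ≤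
      4 * Fintype.card Y / (k : ℝ) ^ 2 * Fintype.card (X → Y) := by
  have hY : (0 : ℝ) < Fintype.card Y := by exact_mod_cast Fintype.card_pos
  obtain ⟨F₁, hF₁, hc₁⟩ := Finset.exists_subset_card_eq (s := F) (n := k) (by omega)
  obtain ⟨F₂, hF₂, hc₂⟩ := Finset.exists_subset_card_eq (s := F \ F₁) (n := k) (by
    rw [Finset.card_sdiff_of_subset hF₁]; omega)
  have hdisj : ∀ z ∈ F₁, ∀ z' ∈ F₂, z ≠ z' := by
    rintro z hz z' hz' rfl
    exact (Finset.mem_sdiff.1 (hF₂ hz')).2 hz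
  let E : X × X → (X → Y) → Prop := fun c G => G c.1 = G c.2
  have hsingle : ∀ c ∈ F₁ ×ˢ F₂, ((Finset.univ.filter (E c)).card : ℝ) =
      1 / Fintype.card Y * Fintype.card (X → Y) := by
    rintro ⟨z, z'⟩ hc
    obtain ⟨hz, hz'⟩ := Finset.mem_product.1 hc
    have := card_filter_and_of_existsUnique (E (z, z')) (fun _ => True) z
      (fun G => ⟨G z', by simp [E, Function.update_of_ne (hdisj z hz z' hz').symm],
        fun v hv => by simpa [E, Function.update_of_ne (hdisj z hz z' hz').symm] using hv⟩)
      (fun _ _ => Iff.rfl)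
    simpa using this
  have hpair : ∀ c ∈ F₁ ×ˢ F₂, ∀ d ∈ F₁ ×ˢ F₂, c ≠ d →
      ((Finset.univ.filter fun G => E c G ∧ E d G).card : ℝ) ≤
        (1 / Fintype.card Y) ^ 2 * Fintype.card (X → Y) := by
    rintro ⟨z, z'⟩ hc ⟨w, w'⟩ hd hne
    obtain ⟨hz, hz'⟩ := Finset.mem_product.1 hc
    obtain ⟨hw, hw'⟩ := Finset.mem_product.1 hd
    have h1 := hdisj z hz z' hz'
    refine le_of_eq ?_
    rw [sq, mul_assoc, ← hsingle (w, w') hd]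
    by_cases hzw : z = w
    · have hzw' : z' ≠ w' := fun h => hne (by rw [hzw, h])
      have h2 := hdisj w hw z' hz'
      refine card_filter_and_of_existsUnique (E (z, z')) (E (w, w')) z'
        (fun G => ⟨G z, by simp [E, Function.update_of_ne h1],
          fun v hv => ?_⟩) (fun G v => ?_)
      · simpa [E, Function.update_of_ne h1] using Eq.symm hv
      · simp only [E]
        rw [Function.update_of_ne h2, Function.update_of_ne hzw'.symm]
    · have h2 := hdisj z hz w' hw'
      refine card_filter_and_of_existsUnique (E (z, z')) (E (w, w')) z
        (fun G => ⟨G z', by simp [E, Function.update_of_ne h1.symm],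
          fun v hv => ?_⟩) (fun G v => ?_)
      · simpa [E, Function.update_of_ne h1.symm] using hv
      · simp only [E]
        rw [Function.update_of_ne (Ne.symm hzw), Function.update_of_ne h2.symm]
  have hI : ((F₁ ×ˢ F₂).card : ℝ) * (1 / Fintype.card Y) = (k : ℝ) ^ 2 / Fintype.card Y := by
    rw [Finset.card_product, hc₁, hc₂]
    push_cast
    ring
  have hμ : 2 ≤ (k : ℝ) ^ 2 / Fintype.card Y := by rwa [le_div_iff₀ hY]
  have key := card_few_events_le (F₁ ×ˢ F₂) E hsingle hpair (k := 1)
    (by rw [hI]; push_cast; linarith) (by rw [hI]; linarith)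
  rw [hI] at key
  have e : 4 / ((k : ℝ) ^ 2 / Fintype.card Y) = 4 * Fintype.card Y / (k : ℝ) ^ 2 := by
    rw [div_div_eq_mul_div]
  rw [e] at key
  refine le_trans (Nat.cast_le.2 (Finset.card_le_card fun G hG => ?_)) key
  refine Finset.mem_filter.2 ⟨Finset.mem_univ _, ?_⟩
  rw [Nat.lt_one_iff, Finset.card_eq_zero, Finset.filter_eq_empty_iff]
  rintro ⟨z, z'⟩ hc h
  obtain ⟨hz, hz'⟩ := Finset.mem_product.1 hc
  exact hdisj z hz z' hz' ((Finset.mem_filter.1 hG).2 (hF₁ hz)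
    (Finset.mem_sdiff.1 (hF₂ hz')).1 h)

end SecondMoment

/-! ### Valid tuples in blocks -/

section Blocks

variable {ℓ M N : ℕ}

/-- Cut the first `ℓ * q` points into `ℓ` consecutive blocks of length `q`; the tuple picks the
`a i`-th point of the `i`-th block. Such tuples are increasing. -/
def blockTuple {q : ℕ} (hq : ℓ * q ≤ M) (a : Fin ℓ → Fin q) : Tuple ℓ M :=
  fun i => Fin.castLE hq (finProdFinEquiv (i, a i))

theorem blockTuple_eq_iff {q : ℕ} (hq : ℓ * q ≤ M) {a b : Fin ℓ → Fin q} {i j : Fin ℓ} :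
    blockTuple hq a i = blockTuple hq b j ↔ i = j ∧ a i = b j := by
  rw [blockTuple, blockTuple, (Fin.castLE_injective hq).eq_iff, finProdFinEquiv.injective.eq_iff,
    Prod.mk.injEq]

theorem blockTuple_strictMono {q : ℕ} (hq : ℓ * q ≤ M) (a : Fin ℓ → Fin q) :
    StrictMono (blockTuple hq a) := by
  intro i j hij
  rw [Fin.lt_def]
  simp only [blockTuple, Fin.val_castLE, finProdFinEquiv_apply_val]
  have h1 : (i : ℕ) + 1 ≤ j := hij
  have h2 : q * ((i : ℕ) + 1) ≤ q * j := Nat.mul_le_mul_left q h1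
  have h3 := (a i).2
  rw [Nat.mul_add, mul_one] at h2
  omega

theorem blockTuple_lt {q : ℕ} (hq : ℓ * q ≤ M) (a : Fin ℓ → Fin q) (i : Fin ℓ) :
    (blockTuple hq a i : ℕ) < ℓ * q :=
  (finProdFinEquiv (i, a i)).2

theorem blockTuple_injective {q : ℕ} (hq : ℓ * q ≤ M) :
    Function.Injective (blockTuple (ℓ := ℓ) hq) :=
  fun _ _ h => funext fun i => ((blockTuple_eq_iff hq).1 (congrFun h i)).2

open Classical in
/-- The block tuples that are valid for `H` and `y`. -/
noncomputable def validBlockTuples {q : ℕ} (hq : ℓ * q ≤ M) (H : Fin M → Fin N) (y : Fin N) :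
    Finset (Tuple ℓ M) :=
  (Finset.univ.image (blockTuple hq)).filter fun x =>
    ∑ i, residue N (H (x i)) = residue N y

theorem validBlockTuples_subset {q : ℕ} (hq : ℓ * q ≤ M) (H : Fin M → Fin N) (y : Fin N) :
    validBlockTuples hq H y ⊆ validTuples H y := by
  intro x hx
  obtain ⟨hx, hs⟩ := Finset.mem_filter.1 hx
  obtain ⟨a, -, rfl⟩ := Finset.mem_image.1 hx
  exact mem_validTuples.2 ⟨blockTuple_strictMono hq a, (sum_residue_eq_iff _ _ _).1 hs⟩

theorem validBlockTuples_congr {q : ℕ} (hq : ℓ * q ≤ M) {H H' : Fin M → Fin N} (y : Fin N)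
    (h : ∀ x : Fin M, (x : ℕ) < ℓ * q → H x = H' x) :
    validBlockTuples hq H y = validBlockTuples hq H' y := by
  refine Finset.filter_congr fun x hx => ?_
  obtain ⟨a, -, rfl⟩ := Finset.mem_image.1 hx
  simp only [h _ (blockTuple_lt hq a _)]

theorem residue_bijective (hN : 0 < N) : Function.Bijective (residue N) := by
  have : NeZero N := ⟨hN.ne'⟩
  rw [Fintype.bijective_iff_injective_and_card]
  exact ⟨residue_injective N, by simp⟩

open Classical in
/-- With `q ^ ℓ / N` expected valid block tuples, the number of them is unlikely to be less than
half of that. Validity of different block tuples is pairwise independent, as each contains a point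
that the other one misses. -/
theorem card_few_validBlockTuples_le {q k : ℕ} (hℓ : 1 ≤ ℓ) (hq : ℓ * q ≤ M) (hN : 0 < N)
    (hq0 : 0 < q) (y : Fin N) (hk : 2 * k * N ≤ q ^ ℓ) :
    ((Finset.univ.filter fun H : Fin M → Fin N => (validBlockTuples hq H y).card < k).card : ℝ) ≤
      4 * N / (q : ℝ) ^ ℓ * Fintype.card (Fin M → Fin N) := by
  have : Nonempty (Fin N) := ⟨y⟩
  have hN' : (0 : ℝ) < N := by exact_mod_cast hN
  have hq' : (0 : ℝ) < q := by exact_mod_cast hq0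
  let E : (Fin ℓ → Fin q) → (Fin M → Fin N) → Prop := fun a H =>
    ∑ i, residue N (H (blockTuple hq a i)) = residue N y
  have hcard : ∀ H, (validBlockTuples hq H y).card = (Finset.univ.filter fun a => E a H).card := by
    intro H
    rw [validBlockTuples, Finset.filter_image, Finset.card_image_of_injective _
      (blockTuple_injective hq)]
  have hunique : ∀ (a : Fin ℓ → Fin q) (i : Fin ℓ) (H : Fin M → Fin N),
      ∃! v, E a (Function.update H (blockTuple hq a i) v) := by
    intro a i H
    have hsum : ∀ v, ∑ j, residue N (Function.update H (blockTuple hq a i) v (blockTuple hq a j)) =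
        residue N v + ∑ j ∈ Finset.univ.erase i, residue N (H (blockTuple hq a j)) := by
      intro v
      rw [← Finset.add_sum_erase _ _ (Finset.mem_univ i), Function.update_self]
      congr 1
      refine Finset.sum_congr rfl fun j hj => ?_
      rw [Function.update_of_ne]
      intro h
      exact Finset.ne_of_mem_erase hj ((blockTuple_eq_iff hq).1 h).1
    simp only [E, hsum, ← eq_sub_iff_add_eq]
    exact (residue_bijective hN).existsUnique _
  have hsingle : ∀ a ∈ (Finset.univ : Finset (Fin ℓ → Fin q)),
      ((Finset.univ.filter (E a)).card : ℝ) = 1 / N * Fintype.card (Fin M → Fin N) := by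
    intro a _
    have := card_filter_and_of_existsUnique (E a) (fun _ => True) (blockTuple hq a ⟨0, hℓ⟩)
      (hunique a ⟨0, hℓ⟩) (fun _ _ => Iff.rfl)
    simpa using this
  have hpair : ∀ a ∈ (Finset.univ : Finset (Fin ℓ → Fin q)),
      ∀ b ∈ (Finset.univ : Finset (Fin ℓ → Fin q)), a ≠ b →
      ((Finset.univ.filter fun H => E a H ∧ E b H).card : ℝ) ≤
        (1 / N) ^ 2 * Fintype.card (Fin M → Fin N) := by
    intro a _ b hb hab
    obtain ⟨i, hi⟩ := Function.ne_iff.1 hab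
    refine le_of_eq ?_
    rw [sq, mul_assoc, ← hsingle b hb]
    have := card_filter_and_of_existsUnique (E a) (E b) (blockTuple hq a i) (hunique a i) ?_
    · rw [Fintype.card_fin] at this
      convert this
    · intro H v
      simp only [E]
      have : ∀ j, Function.update H (blockTuple hq a i) v (blockTuple hq b j) =
          H (blockTuple hq b j) := by
        intro j
        rw [Function.update_of_ne]
        intro h
        obtain ⟨rfl, h'⟩ := (blockTuple_eq_iff hq).1 h
        exact hi h'.symm
      simp only [this]
  have hI : ((Finset.univ : Finset (Fin ℓ → Fin q)).card : ℝ) * (1 / N) = (q : ℝ) ^ ℓ / N := by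
    rw [Finset.card_univ, Fintype.card_fun, Fintype.card_fin, Fintype.card_fin]
    push_cast
    ring
  have key := card_few_events_le Finset.univ E hsingle hpair (k := k) ?_ ?_
  · rw [hI, div_div_eq_mul_div] at key
    simpa only [hcard] using key
  · rw [hI, le_div_iff₀ hN']
    exact_mod_cast hk
  · rw [hI]
    positivity

end Blocks

/-! ### The upper bound -/

section UpperBound

open Classical in
/-- The table algorithm, with block tuples as candidates, fails only if there are few valid block
tuples or if `G` is injective on the first ones. -/
theorem exists_algorithm_winProb_ge {ℓ M N N₀ q k : ℕ} (hℓ : 1 ≤ ℓ) (hq0 : 0 < q)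
    (hq : ℓ * q ≤ M) (hN : 0 < N) (hN₀ : 0 < N₀) (hk : 4 * k * N ≤ q ^ ℓ)
    (hk' : 2 * (N₀ : ℝ) ≤ (k : ℝ) ^ 2) {p : ℝ}
    (hp : 4 * N / (q : ℝ) ^ ℓ + 4 * N₀ / (k : ℝ) ^ 2 ≤ 1 - p) :
    ∃ (S : ℕ) (P : DetAlgorithm ℓ M N N₀ S), ∀ y,
      ENNReal.ofReal p ≤ P.winProb (ℓ * q + 2 * k) y := by
  have : Nonempty (Fin N) := ⟨⟨0, hN⟩⟩
  have : Nonempty (Fin N₀) := ⟨⟨0, hN₀⟩⟩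
  have hM : 0 < M := lt_of_lt_of_le (Nat.mul_pos hℓ hq0) hq
  obtain ⟨S, P, hP⟩ := exists_tableAlgorithm (ℓ * q) (2 * k) hq hM hN hN₀
    (fun y H => (validBlockTuples hq H y).toList)
    (fun y h h' hh => by rw [validBlockTuples_congr hq y hh])
    (fun y h x hx => validBlockTuples_subset hq h y (Finset.mem_toList.1 hx))
  refine ⟨S, P, fun y => ?_⟩
  let F := fun H => ((validBlockTuples (ℓ := ℓ) hq H y).toList.take (2 * k)).toFinset
  let few := fun H => (validBlockTuples (ℓ := ℓ) hq H y).card < 2 * k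
  let win := fun (H : Fin M → Fin N) (G : Tuple ℓ M → Fin N₀) => P.Wins (ℓ * q + 2 * k) H G y
  have hFcard : ∀ H, ¬ few H → 2 * k ≤ (F H).card := by
    intro H hH
    have hnd : ((validBlockTuples (ℓ := ℓ) hq H y).toList.take (2 * k)).Nodup :=
      (Finset.nodup_toList _).sublist (List.take_sublist _ _)
    simp only [F]
    rw [List.toFinset_card_of_nodup hnd, List.length_take, Finset.length_toList]
    exact le_min le_rfl (not_lt.1 hH)
  have hwin : ∀ H G, ¬ Set.InjOn G (F H) → win H G := by
    intro H G hG
    simp only [Set.InjOn, not_forall] at hG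
    obtain ⟨x, hx, x', hx', heq, hne⟩ := hG
    exact hP H G y ⟨x, by simpa [F] using hx, x', by simpa [F] using hx', hne, heq⟩
  have hinj : ∀ H, ¬ few H → ∑ G : Tuple ℓ M → Fin N₀, (if Set.InjOn G (F H) then (1 : ℝ) else 0) ≤
      4 * N₀ / (k : ℝ) ^ 2 * Fintype.card (Tuple ℓ M → Fin N₀) := by
    intro H hH
    have := card_injOn_le (Y := Fin N₀) (F H) k (hFcard H hH) (by simpa using hk')
    rw [Finset.card_filter] at this
    push_cast at this
    simpa using this
  have hfew : ∑ H, (if few H then (1 : ℝ) else 0) ≤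
      4 * N / (q : ℝ) ^ ℓ * Fintype.card (Fin M → Fin N) := by
    have := card_few_validBlockTuples_le (k := 2 * k) hℓ hq hN hq0 y
      (by rwa [← mul_assoc])
    refine le_trans (le_of_eq ?_) this
    rw [Finset.card_filter]
    push_cast
    exact Finset.sum_congr rfl fun H _ => by congr
  have hlose : ∑ H, ∑ G, (if win H G then (0 : ℝ) else 1) ≤
      (1 - p) * (Fintype.card (Fin M → Fin N) * Fintype.card (Tuple ℓ M → Fin N₀)) := by
    have h1 : ∀ H, ∑ G, (if win H G then (0 : ℝ) else 1) ≤
        (if few H then (1 : ℝ) else 0) * Fintype.card (Tuple ℓ M → Fin N₀) +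
          4 * N₀ / (k : ℝ) ^ 2 * Fintype.card (Tuple ℓ M → Fin N₀) := by
      intro H
      by_cases hH : few H
      · rw [if_pos hH, one_mul]
        have h2 : ∑ G, (if win H G then (0 : ℝ) else 1) ≤
            ∑ _G : Tuple ℓ M → Fin N₀, (1 : ℝ) :=
          Finset.sum_le_sum fun G _ => by split_ifs <;> norm_num
        rw [Finset.sum_const, nsmul_eq_mul, mul_one, Finset.card_univ] at h2
        have : 0 ≤ 4 * N₀ / (k : ℝ) ^ 2 * (Fintype.card (Tuple ℓ M → Fin N₀) : ℝ) := by positivity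
        linarith
      · rw [if_neg hH, zero_mul, zero_add]
        refine le_trans (Finset.sum_le_sum fun G _ => ?_) (hinj H hH)
        by_cases hw : win H G
        · rw [if_pos hw]; positivity
        · rw [if_neg hw, if_pos (by by_contra h; exact hw (hwin H G h))]
    refine (Finset.sum_le_sum fun H _ => h1 H).trans ?_
    rw [Finset.sum_add_distrib, ← Finset.sum_mul, Finset.sum_const, nsmul_eq_mul, Finset.card_univ]
    have h2 := mul_le_mul_of_nonneg_right hfew
      (Nat.cast_nonneg (α := ℝ) (Fintype.card (Tuple ℓ M → Fin N₀)))
    have h3 := mul_le_mul_of_nonneg_right hp (by positivity :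
      (0 : ℝ) ≤ Fintype.card (Fin M → Fin N) * Fintype.card (Tuple ℓ M → Fin N₀))
    linarith
  have hcard : p * Nat.card ((Fin M → Fin N) × (Tuple ℓ M → Fin N₀)) ≤
      (Nat.card {O : (Fin M → Fin N) × (Tuple ℓ M → Fin N₀) //
        P.Wins (ℓ * q + 2 * k) O.1 O.2 y} : ℝ) := by
    have e1 : (Nat.card {O : (Fin M → Fin N) × (Tuple ℓ M → Fin N₀) //
        P.Wins (ℓ * q + 2 * k) O.1 O.2 y} : ℝ) =
        ∑ H, ∑ G, if win H G then (1 : ℝ) else 0 := by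
      rw [Nat.card_eq_fintype_card, Fintype.card_subtype, Finset.card_filter,
        ← Fintype.sum_prod_type' fun H G => if win H G then (1 : ℝ) else 0]
      push_cast
      rfl
    have e2 : ∑ H, ∑ G, (if win H G then (1 : ℝ) else 0) +
        ∑ H, ∑ G, (if win H G then (0 : ℝ) else 1) =
        Fintype.card (Fin M → Fin N) * Fintype.card (Tuple ℓ M → Fin N₀) := by
      rw [← Finset.sum_add_distrib]
      simp only [← Finset.sum_add_distrib]
      rw [Finset.sum_congr rfl fun H _ => Finset.sum_congr rfl fun G _ =>
        show (if win H G then (1 : ℝ) else 0) + (if win H G then (0 : ℝ) else 1) = 1 by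
          split_ifs <;> norm_num]
      simp only [Finset.sum_const, nsmul_eq_mul, mul_one, Finset.card_univ]
    rw [e1, Nat.card_prod, Nat.card_eq_fintype_card, Nat.card_eq_fintype_card]
    push_cast at e2 hlose ⊢
    linarith
  have hpos : (Nat.card ((Fin M → Fin N) × (Tuple ℓ M → Fin N₀)) : ℝ≥0∞) ≠ 0 := by
    exact_mod_cast Nat.card_pos.ne'
  rw [DetAlgorithm.winProb, ENNReal.le_div_iff_mul_le (Or.inl hpos)
    (Or.inl (ENNReal.natCast_ne_top _)), ← ENNReal.ofReal_natCast, ← ENNReal.ofReal_natCast,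
    ← ENNReal.ofReal_mul' (by positivity)]
  exact ENNReal.ofReal_le_ofReal hcard

theorem le_successProb_pure {ℓ M N N₀ S T : ℕ} {q : ℝ≥0∞} (P : DetAlgorithm ℓ M N N₀ S)
    (D : PMF (Fin N)) (h : ∀ y, q ≤ P.winProb T y) : q ≤ successProb (PMF.pure P) D T := by
  have hD : ∑ y, D y = 1 := by rw [← tsum_fintype (L := .unconditional _)]; exact D.tsum_coe
  calc q = ∑ y, D y * q := by rw [← Finset.sum_mul, hD, one_mul]
    _ ≤ ∑ y, D y * P.winProb T y := Finset.sum_le_sum fun y _ => mul_le_mul_right (h y) _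
    _ = PMF.pure P P * ∑ y, D y * P.winProb T y := by simp
    _ ≤ _ := ENNReal.le_tsum (f := fun P' => PMF.pure P P' * ∑ y, D y * P'.winProb T y) P

theorem queries_upper_bound {ℓ : ℕ} {ε c₂ : ℝ} {N₀ : ℕ → ℕ} (hℓ : 2 ≤ ℓ) (hε : 0 < ε)
    (hε2 : ε ≤ 2 / ((ℓ : ℝ) - 1)) (hc₂ : 0 < c₂)
    (hN₀ : ∀ᶠ N : ℕ in atTop, 0 < N₀ N ∧ (N₀ N : ℝ) ≤ c₂ * (N : ℝ) ^ ε) {p : ℝ} (hp : p < 1) :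
    ∃ C : ℝ, 0 < C ∧ ∀ᶠ N : ℕ in atTop,
      ∀ M : ℕ, C * (N : ℝ) ^ (1 / (ℓ : ℝ) + ε / (2 * (ℓ : ℝ))) ≤ M →
        ∃ (S T : ℕ) (A : RandAlgorithm ℓ M N (N₀ N) S),
          (T : ℝ) ≤ C * (N : ℝ) ^ (1 / (ℓ : ℝ) + ε / (2 * (ℓ : ℝ))) ∧
          ∀ D : PMF (Fin N), ENNReal.ofReal p ≤ successProb A D T := by
  have hℓ1 : 1 ≤ ℓ := by omega
  have hℓ2 : (2 : ℝ) ≤ ℓ := by exact_mod_cast hℓ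
  have hℓ0 : (0 : ℝ) < ℓ := by linarith
  -- the algorithm queries `G` at about `2 * B * N ^ (ε / 2)` valid tuples
  obtain ⟨B, hB1, hB2⟩ : ∃ B : ℝ, 1 ≤ B ∧ 2 * c₂ + 8 * c₂ / (1 - p) ≤ B ^ 2 := by
    have hp' : 0 < 1 - p := by linarith
    refine ⟨1 + (2 * c₂ + 8 * c₂ / (1 - p)), ?_, ?_⟩
    · have : 0 ≤ 2 * c₂ + 8 * c₂ / (1 - p) := by positivity
      linarith
    · have : 0 ≤ 2 * c₂ + 8 * c₂ / (1 - p) := by positivity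
      nlinarith
  refine ⟨ℓ * ((8 * B) ^ (1 / (ℓ : ℝ)) + 1) + 4 * B, by positivity, ?_⟩
  filter_upwards [hN₀, eventually_ge_atTop 1,
    eventually_le_natCast_rpow (2 / (1 - p)) (half_pos hε)] with N hN0 hN1 hNp M hM
  obtain ⟨hN0, hN0le⟩ := hN0
  have hp' : 0 < 1 - p := by linarith
  have hN1' : (1 : ℝ) ≤ N := by exact_mod_cast hN1
  have hN : (0 : ℝ) < N := by linarith
  set X : ℝ := (N : ℝ) ^ (1 / (ℓ : ℝ) + ε / (2 * (ℓ : ℝ))) with hX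
  have hX1 : 1 ≤ X := Real.one_le_rpow hN1' (by positivity)
  have hXpow : X ^ ℓ = N * (N : ℝ) ^ (ε / 2) := rpow_queries_pow hℓ1 ε hN
  set Z : ℝ := (N : ℝ) ^ (ε / 2) with hZ
  have hZ1 : 1 ≤ Z := Real.one_le_rpow hN1' (by positivity)
  have hZsq : Z ^ 2 = (N : ℝ) ^ ε := rpow_half_sq hN.le ε
  -- this is where `ε ≤ 2 / (ℓ - 1)` is needed
  have hZX : Z ≤ X := by
    refine Real.rpow_le_rpow_of_exponent_le hN1' ?_
    rw [le_div_iff₀ (by linarith)] at hε2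
    have : 1 / (ℓ : ℝ) + ε / (2 * (ℓ : ℝ)) - ε / 2 = (2 - ε * (ℓ - 1)) / (2 * ℓ) := by
      field_simp
      ring
    have h2 : 0 ≤ (2 - ε * ((ℓ : ℝ) - 1)) / (2 * ℓ) := div_nonneg (by linarith) (by positivity)
    linarith
  set k := ⌈B * Z⌉₊ with hk
  have hkge : B * Z ≤ k := Nat.le_ceil _
  have hBZ : 1 ≤ B * Z := by nlinarith
  have hkle : (k : ℝ) ≤ 2 * B * Z := by
    have : (k : ℝ) < B * Z + 1 := Nat.ceil_lt_add_one (by linarith)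
    linarith
  set q := ⌈(8 * B) ^ (1 / (ℓ : ℝ)) * X⌉₊ with hqdef
  have hB0 : 0 ≤ 8 * B := by linarith
  have hqX0 : 0 < (8 * B) ^ (1 / (ℓ : ℝ)) * X := by
    have : 0 < 8 * B := by linarith
    positivity
  have hq0 : 0 < q := Nat.ceil_pos.2 hqX0
  have hqle : (q : ℝ) ≤ ((8 * B) ^ (1 / (ℓ : ℝ)) + 1) * X := by
    have : (q : ℝ) < (8 * B) ^ (1 / (ℓ : ℝ)) * X + 1 := Nat.ceil_lt_add_one hqX0.le
    linarith
  have hqpow : 8 * B * (N * Z) ≤ (q : ℝ) ^ ℓ := by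
    calc 8 * B * (N * Z) = ((8 * B) ^ (1 / (ℓ : ℝ)) * X) ^ ℓ := by
          rw [mul_pow, rpow_one_div_pow hℓ1 hB0, hXpow]
      _ ≤ _ := pow_le_pow_left₀ hqX0.le (Nat.le_ceil _) ℓ
  have hBpos : 0 < B := by linarith
  have hT : ((ℓ * q + 2 * k : ℕ) : ℝ) ≤ (ℓ * ((8 * B) ^ (1 / (ℓ : ℝ)) + 1) + 4 * B) * X := by
    push_cast
    calc (ℓ : ℝ) * q + 2 * k ≤ ℓ * (((8 * B) ^ (1 / (ℓ : ℝ)) + 1) * X) + 2 * (2 * B * X) := by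
          gcongr
          exact hkle.trans (by gcongr)
      _ = _ := by ring
  have hqM : ℓ * q ≤ M := by
    have : ((ℓ * q + 2 * k : ℕ) : ℝ) ≤ M := hT.trans hM
    have : ℓ * q + 2 * k ≤ M := by exact_mod_cast this
    omega
  have hcond : 4 * k * N ≤ q ^ ℓ := by
    have : (4 * k * N : ℝ) ≤ (q : ℝ) ^ ℓ := by
      calc (4 * k * N : ℝ) ≤ 4 * (2 * B * Z) * N := by gcongr
        _ = 8 * B * (N * Z) := by ring
        _ ≤ _ := hqpow
    exact_mod_cast this
  have hkN₀ : (2 + 8 / (1 - p)) * N₀ N ≤ (k : ℝ) ^ 2 := by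
    calc (2 + 8 / (1 - p)) * N₀ N ≤ (2 + 8 / (1 - p)) * (c₂ * (N : ℝ) ^ ε) := by gcongr
      _ = (2 * c₂ + 8 * c₂ / (1 - p)) * Z ^ 2 := by rw [hZsq]; ring
      _ ≤ B ^ 2 * Z ^ 2 := by gcongr
      _ = (B * Z) ^ 2 := by ring
      _ ≤ _ := pow_le_pow_left₀ (by linarith) hkge 2
  have hN0' : (0 : ℝ) < N₀ N := by exact_mod_cast hN0
  have hk1 : 0 ≤ 8 / (1 - p) * (N₀ N : ℝ) := by positivity
  have hk0 : (0 : ℝ) < (k : ℝ) ^ 2 := by nlinarith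
  have hfail : 4 * N / (q : ℝ) ^ ℓ + 4 * N₀ N / (k : ℝ) ^ 2 ≤ 1 - p := by
    have h1 : 4 * N / (q : ℝ) ^ ℓ ≤ (1 - p) / 2 := by
      rw [div_le_iff₀ hp'] at hNp
      rw [div_le_iff₀ (by positivity)]
      have h2 : (1 - p) / 2 * (8 * B * (N * Z)) ≤ (1 - p) / 2 * (q : ℝ) ^ ℓ := by gcongr
      have h3 : 4 * N * 1 ≤ 4 * N * (B * (Z * (1 - p))) := by
        gcongr
        nlinarith
      linarith
    have h2 : 4 * N₀ N / (k : ℝ) ^ 2 ≤ (1 - p) / 2 := by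
      rw [div_le_iff₀ hk0]
      have h3 : (1 - p) / 2 * ((2 + 8 / (1 - p)) * N₀ N) ≤ (1 - p) / 2 * (k : ℝ) ^ 2 := by gcongr
      have h4 : (1 - p) / 2 * ((2 + 8 / (1 - p)) * N₀ N) = (1 - p) * N₀ N + 4 * N₀ N := by
        field_simp
        ring
      have h5 : 0 ≤ (1 - p) * (N₀ N : ℝ) := by positivity
      linarith
    linarith
  obtain ⟨S, P, hP⟩ := exists_algorithm_winProb_ge hℓ1 hq0 hqM (by omega) hN0 hcond
    (by linarith) hfail
  exact ⟨S, ℓ * q + 2 * k, PMF.pure P, hT, fun D => le_successProb_pure P D hP⟩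

end UpperBound

/-! ### The range of `G` -/


theorem eventually_bounds_of_isTheta {ε : ℝ} {N₀ : ℕ → ℕ}
    (h : (fun N : ℕ => (N₀ N : ℝ)) =Θ[atTop] (fun N : ℕ => (N : ℝ) ^ ε)) :
    (∃ c₁ : ℝ, 0 < c₁ ∧ ∀ᶠ N : ℕ in atTop, c₁ * (N : ℝ) ^ ε ≤ N₀ N) ∧
      ∃ c₂ : ℝ, 0 < c₂ ∧ ∀ᶠ N : ℕ in atTop, 0 < N₀ N ∧ (N₀ N : ℝ) ≤ c₂ * (N : ℝ) ^ ε := by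
  have hnorm : ∀ N : ℕ, ‖(N : ℝ) ^ ε‖ = (N : ℝ) ^ ε := fun N =>
    Real.norm_of_nonneg (by positivity)
  have hnorm' : ∀ N : ℕ, ‖(N₀ N : ℝ)‖ = N₀ N := fun N => Real.norm_of_nonneg (by positivity)
  obtain ⟨C, hC, h1⟩ := h.2.exists_pos
  obtain ⟨c₂, hc₂, h2⟩ := h.1.exists_pos
  have h3 : ∀ᶠ N : ℕ in atTop, 1 / C * (N : ℝ) ^ ε ≤ N₀ N := by
    filter_upwards [h1.bound] with N hN
    rw [hnorm, hnorm'] at hN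
    rw [one_div_mul_eq_div, div_le_iff₀ hC]
    linarith
  refine ⟨⟨1 / C, by positivity, h3⟩, c₂, hc₂, ?_⟩
  filter_upwards [h3, h2.bound, eventually_ge_atTop 1] with N hN hN2 hN1
  rw [hnorm, hnorm'] at hN2
  have hN' : (0 : ℝ) < N := by exact_mod_cast hN1
  have : (0 : ℝ) < 1 / C * (N : ℝ) ^ ε := by positivity
  exact ⟨by exact_mod_cast this.trans_le hN, hN2⟩

end NestedCollision

theorem mainTheorem4 :
    -- the general range of parameters
    (∀ (ℓ : ℕ) (ε : ℝ) (N₀ : ℕ → ℕ), 2 ≤ ℓ → 1 / (ℓ : ℝ) < ε → ε ≤ 2 / ((ℓ : ℝ) - 1) →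
      (fun N : ℕ => (N₀ N : ℝ)) =Θ[atTop] (fun N : ℕ => (N : ℝ) ^ ε) →
      -- bounded space: `S ^ ((ℓ² - 1) / (2ℓ)) * T = Ω(N ^ (1 / (2ℓ) + ε / 2))`
      (∀ p a b : ℝ, 0 < p → 0 < a → 0 < b → ∃ c : ℝ, 0 < c ∧ ∀ᶠ N : ℕ in atTop,
        ∀ (M S T : ℕ) (D : PMF (Fin N)) (A : NestedCollision.RandAlgorithm ℓ M N (N₀ N) S),
          a * Real.log N ≤ S → (S : ℝ) ≤ b * (N : ℝ) ^ (1 / ((ℓ : ℝ) ^ 2 - 1)) →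
          ENNReal.ofReal p ≤ NestedCollision.successProb A D T →
          c * (N : ℝ) ^ (1 / (2 * (ℓ : ℝ)) + ε / 2) ≤
            (S : ℝ) ^ (((ℓ : ℝ) ^ 2 - 1) / (2 * (ℓ : ℝ))) * T) ∧
      -- space `O(log N)`: `T = Ω(N ^ (1 / (2ℓ) + ε / 2))`
      (∀ p a : ℝ, 0 < p → 0 < a → ∃ c : ℝ, 0 < c ∧ ∀ᶠ N : ℕ in atTop,
        ∀ (M S T : ℕ) (D : PMF (Fin N)) (A : NestedCollision.RandAlgorithm ℓ M N (N₀ N) S),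
          (S : ℝ) ≤ a * Real.log N →
          ENNReal.ofReal p ≤ NestedCollision.successProb A D T →
          c * (N : ℝ) ^ (1 / (2 * (ℓ : ℝ)) + ε / 2) ≤ T) ∧
      -- unbounded space: `O(N ^ (1 / ℓ + ε / (2ℓ)))` queries suffice
      (∀ p : ℝ, p < 1 → ∃ C : ℝ, 0 < C ∧ ∀ᶠ N : ℕ in atTop,
        ∀ M : ℕ, C * (N : ℝ) ^ (1 / (ℓ : ℝ) + ε / (2 * (ℓ : ℝ))) ≤ M →
          ∃ (S T : ℕ) (A : NestedCollision.RandAlgorithm ℓ M N (N₀ N) S),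
            (T : ℝ) ≤ C * (N : ℝ) ^ (1 / (ℓ : ℝ) + ε / (2 * (ℓ : ℝ))) ∧
            ∀ D : PMF (Fin N), ENNReal.ofReal p ≤ NestedCollision.successProb A D T) ∧
      -- separation: small space forces polynomially more queries than that
      (∃ δ : ℝ, 0 < δ ∧ ∀ p : ℝ, 0 < p → ∀ᶠ N : ℕ in atTop,
        ∀ (M S T : ℕ) (D : PMF (Fin N)) (A : NestedCollision.RandAlgorithm ℓ M N (N₀ N) S),
          (S : ℝ) ≤ (N : ℝ) ^ δ →
          ENNReal.ofReal p ≤ NestedCollision.successProb A D T →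
          (N : ℝ) ^ (1 / (ℓ : ℝ) + ε / (2 * (ℓ : ℝ)) + δ) ≤ T)) ∧
    -- the example `ℓ = 2`, `N₀ = N²`: bounded space needs `S ^ (3/4) * T = Ω(N ^ (5/4))`
    (∀ p a b : ℝ, 0 < p → 0 < a → 0 < b → ∃ c : ℝ, 0 < c ∧ ∀ᶠ N : ℕ in atTop,
      ∀ (M S T : ℕ) (D : PMF (Fin N)) (A : NestedCollision.RandAlgorithm 2 M N (N ^ 2) S),
        a * Real.log N ≤ S → (S : ℝ) ≤ b * (N : ℝ) ^ (1 / 3 : ℝ) →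
        ENNReal.ofReal p ≤ NestedCollision.successProb A D T →
        c * (N : ℝ) ^ (5 / 4 : ℝ) ≤ (S : ℝ) ^ (3 / 4 : ℝ) * T) ∧
    -- the example with polylogarithmic space
    (∀ (p : ℝ) (k : ℕ), 0 < p → ∃ k' : ℕ, ∀ᶠ N : ℕ in atTop,
      ∀ (M S T : ℕ) (D : PMF (Fin N)) (A : NestedCollision.RandAlgorithm 2 M N (N ^ 2) S),
        (S : ℝ) ≤ Real.log N ^ k →
        ENNReal.ofReal p ≤ NestedCollision.successProb A D T →
        (N : ℝ) ^ (5 / 4 : ℝ) / Real.log N ^ k' ≤ T) ∧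
    -- the example with unbounded space: `O(N)` queries suffice
    (∀ p : ℝ, p < 1 → ∃ C : ℝ, 0 < C ∧ ∀ᶠ N : ℕ in atTop,
      ∀ M : ℕ, C * (N : ℝ) ≤ M →
        ∃ (S T : ℕ) (A : NestedCollision.RandAlgorithm 2 M N (N ^ 2) S),
          (T : ℝ) ≤ C * (N : ℝ) ∧
          ∀ D : PMF (Fin N), ENNReal.ofReal p ≤ NestedCollision.successProb A D T) ∧
    -- and `O(N)` is optimal
    (∀ p : ℝ, 0 < p → ∃ c : ℝ, 0 < c ∧ ∀ᶠ N : ℕ in atTop,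
      ∀ (M S T : ℕ) (D : PMF (Fin N)) (A : NestedCollision.RandAlgorithm 2 M N (N ^ 2) S),
        ENNReal.ofReal p ≤ NestedCollision.successProb A D T → c * (N : ℝ) ≤ T) := by
  refine ⟨?_, ?_, ?_, ?_, ?_⟩
  · intro ℓ ε N₀ hℓ hε hε2 hΘ
    have hℓ2 : (2 : ℝ) ≤ ℓ := by exact_mod_cast hℓ
    have hℓ0 : (0 : ℝ) < ℓ := by linarith
    have hε0 : 0 < ε := lt_trans (by positivity) hε
    have hε2' : ε ≤ 2 := hε2.trans (div_le_self two_pos.le (by linarith))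
    obtain ⟨⟨c₁, hc₁, h1⟩, c₂, hc₂, h2⟩ := NestedCollision.eventually_bounds_of_isTheta hΘ
    refine ⟨?_, ?_, ?_, ?_⟩
    · intro p a b hp ha hb
      exact NestedCollision.tradeoff_lower_bound hℓ hε0 hε2' hc₁ h1 hp ha hb
    · intro p a hp ha
      refine ⟨1, one_pos, ?_⟩
      -- for this `δ` the loss `N ^ (ℓ * δ)` is `N ^ (1 / (2 * ℓ))`
      have hδ : (0 : ℝ) < 1 / (2 * (ℓ : ℝ) ^ 2) := by positivity
      have hδε : 1 / (2 * (ℓ : ℝ) ^ 2) < ε / 2 := by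
        have : 1 / (2 * (ℓ : ℝ) ^ 2) ≤ 1 / (ℓ : ℝ) / 2 := by
          rw [div_div]
          exact one_div_le_one_div_of_le (by positivity) (by nlinarith)
        linarith
      filter_upwards [NestedCollision.small_space_lower_bound hℓ hε0 hε2' hc₁ h1 hp hδ hδε,
        NestedCollision.eventually_mul_log_le_rpow a hδ] with N hN hlog M S T D A hS hA
      have := hN M S T D A (hS.trans hlog) hA
      rw [one_mul]
      convert this using 2
      field_simp
      ring
    · intro p hp
      exact NestedCollision.queries_upper_bound hℓ hε0 hε2 hc₂ h2 hp
    · refine ⟨ε / (4 * (ℓ + 1)), by positivity, fun p hp => ?_⟩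
      have hδε : ε / (4 * ((ℓ : ℝ) + 1)) < ε / 2 :=
        div_lt_div_of_pos_left hε0 two_pos (by linarith)
      filter_upwards [NestedCollision.small_space_lower_bound hℓ hε0 hε2' hc₁ h1 hp
        (by positivity) hδε, eventually_ge_atTop 1] with N hN hN1 M S T D A hS hA
      refine le_trans (Real.rpow_le_rpow_of_exponent_le (by exact_mod_cast hN1) ?_)
        (hN M S T D A hS hA)
      have e1 : ε / (2 * (ℓ : ℝ)) ≤ ε / 4 :=
        div_le_div_of_nonneg_left hε0.le (by norm_num) (by linarith)
      have e2 : ε / (4 * ((ℓ : ℝ) + 1)) + ℓ * (ε / (4 * ((ℓ : ℝ) + 1))) = ε / 4 := by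
        field_simp
        ring
      linarith
  all_goals
    have hsq : ∀ᶠ N : ℕ in atTop, (1 : ℝ) * (N : ℝ) ^ (2 : ℝ) ≤ ((N ^ 2 : ℕ) : ℝ) :=
      Eventually.of_forall fun N => by
        push_cast
        rw [one_mul, Real.rpow_two]
  · intro p a b hp ha hb
    have := NestedCollision.tradeoff_lower_bound le_rfl two_pos le_rfl one_pos hsq hp ha hb
    norm_num at this ⊢
    exact this
  · intro p k hp
    -- the argument gives `N ^ (5 / 4)` without a logarithmic loss
    refine ⟨0, ?_⟩
    have hpoly : ∀ᶠ N : ℕ in atTop, Real.log N ^ k ≤ (N : ℝ) ^ (1 / 8 : ℝ) := by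
      have h := (Real.isLittleO_pow_log_id_atTop (n := 8 * k)).comp_tendsto tendsto_natCast_atTop_atTop
      filter_upwards [h.bound one_pos] with N hN
      simp only [Function.comp_apply, id, one_mul, Real.norm_natCast] at hN
      have h0 : (0 : ℝ) ≤ (N : ℝ) := by positivity
      refine le_of_pow_le_pow_left₀ (n := 8) (by norm_num) (by positivity) ?_
      rw [← pow_mul, mul_comm k, ← Real.rpow_natCast ((N : ℝ) ^ (1 / 8 : ℝ)), ← Real.rpow_mul h0]
      norm_num
      exact (le_abs_self _).trans hN
    filter_upwards [hpoly, NestedCollision.small_space_lower_bound le_rfl two_pos le_rfl one_pos hsq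
      hp (by norm_num : (0 : ℝ) < 1 / 8) (by norm_num)] with N hlog hN M S T D A hS hA
    have := hN M S T D A (hS.trans hlog) hA
    norm_num at this ⊢
    exact this
  · intro p hp
    have := NestedCollision.queries_upper_bound (N₀ := fun N => N ^ 2) (ε := 2) le_rfl two_pos
      (by norm_num) one_pos
      (by
        filter_upwards [eventually_ge_atTop 1] with N hN
        refine ⟨by positivity, ?_⟩
        push_cast
        rw [one_mul, Real.rpow_two]) hp
    norm_num at this ⊢
    exact this
  · intro p hp
    have := NestedCollision.queries_lower_bound (ℓ := 2) one_le_two two_pos one_pos hsq hp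
    norm_num at this ⊢
    exact this
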